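/- Let $M$ be a unital $C^*$-algebra and let $M_+^*$ be the set of positive bounded linear forms on $M$, ordered by $\sigma\le\varrho$ iff $\varrho-\sigma$ is positive ($\sigma$ is then called subordinate to $\varrho$). For a unital $*$-representation $\pi$ of $M$ on a Hilbert space $\mathcal K$ and $\mu\in M_+^*$, let $\mathcal S_\pi(\mu)=\{\chi\in\mathcal K:\mu(x)=\langle\pi(x)\chi,\chi\rangle\text{ for all }x\in M\}$. For $\nu,\varrho\in M_+^*$ let $$d_{\mathrm B}(\nu,\varrho)=\inf\|\psi-\varphi\|,\qquad P_M(\nu,\varrho)=\sup|\langle\psi,\varphi\rangle|^2,$$ where the infimum and the supremum extend over all unital $*$-representations $\pi$ of $M$ and all $\varphi\in\mathcal S_\pi(\nu)$, $\psi\in\mathcal S_\pi(\varrho)$. Call $\nu$ and $\varrho$ orthogonal, $\nu\perp\varrho$, if $\|\nu-\varrho\|=\|\nu\|+\|\varrho\|$ in the norm of the dual space $M^*$. For every pair $\nu,\varrho\in M_+^*$ there exist a largest $\varrho^\perp\in M_+^*$ with $\varrho^\perp\le\varrho$ and $\varrho^\perp\perp\nu$, and a largest $\nu^\perp\in M_+^*$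 with $\nu^\perp\le\nu$ and $\nu^\perp\perp\varrho$. The following hold: 1. $(\varrho-\varrho^\perp)^{\perp'}=0$ and $\nu^{\perp'}=\nu^\perp$, where $\perp'$ denotes the same operation with respect to the pair $\{\nu,\varrho-\varrho^\perp\}$; that is, $(\varrho-\varrho^\perp)^{\perp'}$ is the largest positive form subordinate to $\varrho-\varrho^\perp$ and orthogonal to $\nu$, and $\nu^{\perp'}$ is the largest positive form subordinate to $\nu$ and orthogonal to $\varrho-\varrho^\perp$. 2. $d_{\mathrm B}(\nu,\varrho)^2=d_{\mathrm B}(\nu-\nu^\perp,\varrho-\varrho^\perp)^2+d_{\mathrm B}(\nu^\perp,\varrho^\perp)^2$. 3. $P_M(\nu,\varrho)=P_M(\nu-\nu^\perp,\varrho-\varrho^\perp)$. Moreover, $\{\nu-\nu^\perp,\varrho-\varrho^\perp\}$ is the least of all pairs $\{\theta,\theta'\}$ of positive linear forms with $\theta\le\nu$, $\theta'\le\varrho$ and $P_M(\theta,\theta')=P_M(\nu,\varrho)$: it is such a pair, and every such pair satisfies $\nu-\nu^\perp\le\theta$ and $\varrho-\varrho^\perp\le\theta'$. -/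

import Mathlib

open scoped ComplexOrder

universe u

namespace BuresDistance

section Forms

variable {M : Type u} [CStarAlgebra M] [PartialOrder M]

/-- A bounded linear form is positive if it is nonnegative on the positive elements. -/
def IsPositiveForm (f : StrongDual ℂ M) : Prop :=
  ∀ x : M, 0 ≤ x → 0 ≤ f x

/-- The order `σ ≤ ϱ` of linear forms: `σ` is subordinate to `ϱ` if `ϱ - σ` is positive. -/
def Subordinate (σ ϱ : StrongDual ℂ M) : Prop :=
  IsPositiveForm (ϱ - σ)

/-- Orthogonality of (positive) linear forms, through the functional norm. -/
def Orthogonal (ν ϱ : StrongDual ℂ M) : Prop :=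
  ‖ν - ϱ‖ = ‖ν‖ + ‖ϱ‖

/-- `σ` is the largest among the positive linear forms that are subordinate to `ϱ` and
orthogonal to `ν`. -/
structure IsLargestOrthogonal (ν ϱ σ : StrongDual ℂ M) : Prop where
  positive : IsPositiveForm σ
  subordinate : Subordinate σ ϱ
  orthogonal : Orthogonal σ ν
  largest : ∀ τ : StrongDual ℂ M,
    IsPositiveForm τ → Subordinate τ ϱ → Orthogonal τ ν → Subordinate τ σ

open Classical in
/-- `perp ν ϱ` is `ϱ^⊥` with respect to the pair `{ν, ϱ}`: the largest positive linear form
subordinate to `ϱ` and orthogonal to `ν`. With respect to the same pair, `ν^⊥` is `perp ϱ ν`. -/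
noncomputable def perp (ν ϱ : StrongDual ℂ M) : StrongDual ℂ M :=
  if h : ∃ σ, IsLargestOrthogonal ν ϱ σ then h.choose else 0

end Forms

section Bures

variable {M : Type u} [CStarAlgebra M]

/-- The `π`-fibre of `μ`: all vectors `χ` with `μ(x) = ⟨π(x)χ, χ⟩` for all `x`. Mathlib's inner
product is linear in its second argument. -/
def fibre {K : Type u} [NormedAddCommGroup K] [InnerProductSpace ℂ K] [CompleteSpace K]
    (π : M →⋆ₐ[ℂ] (K →L[ℂ] K)) (μ : StrongDual ℂ M) : Set K :=
  {χ | ∀ x : M, μ x = inner ℂ χ (π x χ)}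

/-- `Implements ν ϱ φ ψ`: for some unital `*`-representation of `M` on the Hilbert space `K`, the
vectors `φ` and `ψ` belong to the fibres of `ν` and `ϱ`, respectively. -/
def Implements {K : Type u} [NormedAddCommGroup K] [InnerProductSpace ℂ K] [CompleteSpace K]
    (ν ϱ : StrongDual ℂ M) (φ ψ : K) : Prop :=
  ∃ π : M →⋆ₐ[ℂ] (K →L[ℂ] K), φ ∈ fibre π ν ∧ ψ ∈ fibre π ϱ

/-- The Bures distance: the infimum of `‖ψ - φ‖` over all unital `*`-representations of `M` and
all `φ`, `ψ` in the fibres of `ν`, `ϱ`. The Hilbert spaces range over the universe of `M`; this is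
no restriction, as every pair of vectors lies in the subrepresentation that it generates, which is
a completion of a quotient of `M × M`. -/
noncomputable def buresDist (ν ϱ : StrongDual ℂ M) : ℝ :=
  sInf {r : ℝ | ∃ (K : Type u) (_ : NormedAddCommGroup K) (_ : InnerProductSpace ℂ K)
    (_ : CompleteSpace K) (φ ψ : K), Implements ν ϱ φ ψ ∧ r = ‖ψ - φ‖}

/-- The `*`-algebraic transition probability: the supremum of `|⟨ψ, φ⟩|²` over the same range. -/
noncomputable def transitionProb (ν ϱ : StrongDual ℂ M) : ℝ :=
  sSup {r : ℝ | ∃ (K : Type u) (_ : NormedAddCommGroup K) (_ : InnerProductSpace ℂ K)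
    (_ : CompleteSpace K) (φ ψ : K), Implements ν ϱ φ ψ ∧ r = ‖inner ℂ φ ψ‖ ^ 2}

end Bures

end BuresDistance

/-! Everything is governed by the fidelity F(ν, ϱ): the maximum of |h(1)| over linear forms h with
|h(y*x)|² ≤ ν(y*y) ϱ(x*x). Implementing vectors φ, ψ give the form ⟨φ, π(·)ψ⟩, and GNS turns any
such h back into vectors, so P = F² and d_B² = ν(1) + ϱ(1) - 2F (`transitionProb_eq`,
`buresDist_sq`). By Hahn-Banach, F is also the infimum of ∑ (ν(yᵢ*yᵢ) + ϱ(xᵢ*xᵢ))/2 over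
factorizations 1 = ∑ yᵢ*xᵢ (`exists_dominated_eq_fidelity`); this form of F shows that F = 0 forces
orthogonality (`orthogonal_iff`).

A perturbation argument drives the rest: if ϱ' ≤ ϱ has the same fidelity with ν, then F(ν, ϱ - ϱ') =
0, as otherwise F could be raised to first order at a second-order price (`fidelity_sub_eq_zero`).
So once splitting off ϱ^⊥ is known to preserve F, ϱ - ϱ^⊥ is the least form with that fidelity, and
the theorem follows by monotonicity of F.

For existence (`exists_isLargestOrthogonal`), take the GNS representation of ϱ with cyclic vector η
and an optimal form ⟨ζ, π(·)η⟩. The same perturbation makes c ↦ ⟨ζ, cη⟩ hermitian on the commutant.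
With e the projection onto the closed commutant orbit of η and q the projection onto the closure of
π(M)eζ, the form ϱ^⊥ is that of the vector η - qη: any τ ≤ ϱ orthogonal to ν has a derivative c in
the commutant with c eζ = 0, hence cq = 0. -/

namespace BuresDistance
open ComplexConjugate InnerProductSpace

/-! ### Representations and vector forms -/

section Representations

variable {M : Type u} [CStarAlgebra M]

/-- The orbit map `x ↦ π(x)η` of a vector under a representation. -/
noncomputable def orbit {K : Type u} [NormedAddCommGroup K] [InnerProductSpace ℂ K] [CompleteSpace K]
    (π : M →⋆ₐ[ℂ] (K →L[ℂ] K)) (η : K) : M →ₗ[ℂ] K where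
  toFun x := π x η
  map_add' x y := by simp
  map_smul' c x := by simp

variable {K : Type u} [NormedAddCommGroup K] [InnerProductSpace ℂ K] [CompleteSpace K]
  (π : M →⋆ₐ[ℂ] (K →L[ℂ] K))

@[simp]
theorem orbit_apply (η : K) (x : M) : orbit π η x = π x η := rfl

theorem inner_rep_left (a : M) (v w : K) : ⟪π a v, w⟫_ℂ = ⟪v, π (star a) w⟫_ℂ := by
  rw [map_star, ContinuousLinearMap.star_eq_adjoint, ContinuousLinearMap.adjoint_inner_right]

theorem inner_rep_star_mul (x y : M) (v w : K) :
    ⟪v, π (star y * x) w⟫_ℂ = ⟪π y v, π x w⟫_ℂ := by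
  rw [inner_rep_left, map_mul]; rfl

theorem inner_rep_star_mul_self (x : M) (v : K) :
    (⟪v, π (star x * x) v⟫_ℂ).re = ‖π x v‖ ^ 2 := by
  rw [inner_rep_star_mul]
  exact (inner_self_eq_norm_sq (𝕜 := ℂ) _)

theorem rep_mul_apply (a b : M) (v : K) : π (a * b) v = π a (π b v) := by
  rw [map_mul]; rfl

theorem rep_one_apply (v : K) : π 1 v = v := by
  rw [map_one]; rfl

/-- The vector form `x ↦ ⟨ζ, π(x)ζ⟩`. -/
noncomputable def vectorForm (ζ : K) : StrongDual ℂ M :=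
  LinearMap.mkContinuous
    { toFun := fun x => ⟪ζ, π x ζ⟫_ℂ
      map_add' := fun x y => by simp
      map_smul' := fun c x => by simp } (‖ζ‖ * ‖ζ‖) (fun x => by
    have h1 : ‖π x ζ‖ ≤ ‖x‖ * ‖ζ‖ :=
      ((π x).le_opNorm ζ).trans (by gcongr; exact NonUnitalStarAlgHom.norm_apply_le π x)
    calc ‖⟪ζ, π x ζ⟫_ℂ‖ ≤ ‖ζ‖ * ‖π x ζ‖ := norm_inner_le_norm _ _
      _ ≤ ‖ζ‖ * (‖x‖ * ‖ζ‖) := by gcongr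
      _ = ‖ζ‖ * ‖ζ‖ * ‖x‖ := by ring)

@[simp]
theorem vectorForm_apply (ζ : K) (x : M) : vectorForm π ζ x = ⟪ζ, π x ζ⟫_ℂ := rfl

variable [PartialOrder M] [StarOrderedRing M]

theorem isPositiveForm_iff {f : StrongDual ℂ M} :
    IsPositiveForm f ↔ ∀ x : M, 0 ≤ f (star x * x) := by
  refine ⟨fun h x => h _ (star_mul_self_nonneg x), fun h x hx => ?_⟩
  obtain ⟨y, rfl⟩ := CStarAlgebra.nonneg_iff_eq_star_mul_self.mp hx
  exact h y

theorem isPositiveForm_vectorForm (ζ : K) : IsPositiveForm (vectorForm π ζ) := by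
  refine isPositiveForm_iff.mpr fun x => ?_
  rw [vectorForm_apply, inner_rep_star_mul, inner_self_eq_norm_sq_to_K]
  exact pow_nonneg (Complex.zero_le_real.mpr (norm_nonneg (π x ζ))) 2

end Representations

/-! ### Positive forms, their order and the GNS representation -/

section Positive

variable {M : Type u} [CStarAlgebra M] [PartialOrder M] [StarOrderedRing M]
  {f g : StrongDual ℂ M}

omit [StarOrderedRing M] in
theorem IsPositiveForm.add (hf : IsPositiveForm f) (hg : IsPositiveForm g) :
    IsPositiveForm (f + g) := fun x hx => add_nonneg (hf x hx) (hg x hx)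

/-- The positive elements span the algebra, so vanishing there suffices. -/
theorem IsPositiveForm.eq_zero_of_neg (hf : IsPositiveForm f) (hg : IsPositiveForm (-f)) :
    f = 0 := by
  have h : ∀ x ∈ Submodule.span ℂ {a : M | 0 ≤ a}, f x = 0 := by
    intro x hx
    induction hx using Submodule.span_induction with
    | mem x hx =>
      refine le_antisymm ?_ (hf x hx)
      have := hg x hx
      rw [neg_apply] at this
      exact neg_nonneg.mp this
    | zero => simp
    | add x y _ _ hx hy => rw [map_add, hx, hy, add_zero]
    | smul c x _ hx => rw [map_smul, hx, smul_zero]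
  ext x
  exact h x (by rw [CStarAlgebra.span_nonneg]; trivial)

theorem Subordinate.antisymm (h₁ : Subordinate f g) (h₂ : Subordinate g f) : f = g := by
  refine (sub_eq_zero.mp (IsPositiveForm.eq_zero_of_neg h₁ ?_)).symm
  rw [neg_sub]; exact h₂

omit [StarOrderedRing M] in
theorem Subordinate.trans {k : StrongDual ℂ M} (h₁ : Subordinate f g) (h₂ : Subordinate g k) :
    Subordinate f k := by
  have := IsPositiveForm.add h₂ h₁
  rwa [sub_add_sub_cancel] at this

theorem IsPositiveForm.re_nonneg (hf : IsPositiveForm f) (x : M) : 0 ≤ (f (star x * x)).re :=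
  (Complex.nonneg_iff.mp (isPositiveForm_iff.mp hf x)).1

omit [StarOrderedRing M] in
theorem IsPositiveForm.ofReal_re (hf : IsPositiveForm f) {x : M} (hx : 0 ≤ x) :
    ((f x).re : ℂ) = f x := by
  have := (Complex.nonneg_iff.mp (hf x hx)).2
  apply Complex.ext <;> simp [← this]

theorem IsPositiveForm.mono (hf : IsPositiveForm f) {x y : M} (h : x ≤ y) :
    (f x).re ≤ (f y).re := by
  have := (Complex.nonneg_iff.mp (hf _ (sub_nonneg.mpr h))).1
  rw [map_sub, Complex.sub_re] at this
  linarith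

theorem Subordinate.re_le (h : Subordinate f g) (x : M) :
    (f (star x * x)).re ≤ (g (star x * x)).re := by
  have := IsPositiveForm.re_nonneg h x
  rw [sub_apply, Complex.sub_re] at this
  linarith

theorem subordinate_iff (hf : IsPositiveForm f) (hg : IsPositiveForm g) :
    Subordinate f g ↔ ∀ x : M, (f (star x * x)).re ≤ (g (star x * x)).re := by
  refine ⟨fun h => h.re_le, fun h => isPositiveForm_iff.mpr fun x => ?_⟩
  rw [sub_apply, ← hf.ofReal_re (star_mul_self_nonneg x),
    ← hg.ofReal_re (star_mul_self_nonneg x), ← Complex.ofReal_sub]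
  exact_mod_cast sub_nonneg.mpr (h x)

/-- The GNS construction: a positive form is the vector form of a cyclic vector. -/
theorem IsPositiveForm.exists_cyclic (hf : IsPositiveForm f) :
    ∃ (K : Type u) (_ : NormedAddCommGroup K) (_ : InnerProductSpace ℂ K) (_ : CompleteSpace K)
      (π : M →⋆ₐ[ℂ] (K →L[ℂ] K)) (η : K),
      vectorForm π η = f ∧ DenseRange (orbit π η) := by
  let F : M →ₚ[ℂ] ℂ := PositiveLinearMap.mk₀ f.toLinearMap hf
  have key : ∀ x : M, F.gnsStarAlgHom x ((F.toPreGNS 1 : F.PreGNS) : F.GNS)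
      = ((F.toPreGNS x : F.PreGNS) : F.GNS) := by
    intro x
    simp
  refine ⟨F.GNS, inferInstance, inferInstance, inferInstance, F.gnsStarAlgHom,
    ((F.toPreGNS 1 : F.PreGNS) : F.GNS), ?_, ?_⟩
  · ext x
    rw [vectorForm_apply, key, UniformSpace.Completion.inner_coe, F.preGNS_inner_def]
    simp only [PositiveLinearMap.ofPreGNS_toPreGNS, star_one, one_mul]
    rfl
  · have : (orbit F.gnsStarAlgHom ((F.toPreGNS 1 : F.PreGNS) : F.GNS) : M → F.GNS)
        = (fun v : F.PreGNS => (v : F.GNS)) ∘ F.toPreGNS := by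
      ext x; exact key x
    rw [this]
    exact UniformSpace.Completion.denseRange_coe.comp F.toPreGNS.surjective.denseRange
      (UniformSpace.Completion.continuous_coe _)

theorem IsPositiveForm.norm_eq (hf : IsPositiveForm f) : ‖f‖ = (f 1).re := by
  obtain ⟨K, _, _, _, π, η, rfl, -⟩ := hf.exists_cyclic
  have h1 : (vectorForm π η 1).re = ‖η‖ ^ 2 := by
    rw [vectorForm_apply, rep_one_apply]; exact inner_self_eq_norm_sq (𝕜 := ℂ) _
  apply le_antisymm
  · rw [h1, sq]
    exact LinearMap.mkContinuous_norm_le _ (by positivity) _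
  · have h2 : ‖(1 : M)‖ ≤ 1 := by
      rcases subsingleton_or_nontrivial M with h | h
      · rw [Subsingleton.elim (1 : M) 0, norm_zero]; exact zero_le_one
      · exact CStarRing.norm_one.le
    exact (Complex.re_le_norm _).trans (((vectorForm π η).le_opNorm 1).trans
      (mul_le_of_le_one_right (norm_nonneg _) h2))

end Positive

/-! ### Dominated forms and the fidelity as a dual norm -/

section Dominated

variable {M : Type u} [CStarAlgebra M]

/-- The linear form `h` is dominated by the pair `{ν, ϱ}` with constant `C`:
`|h(y*x)|² ≤ C ν(y*y) ϱ(x*x)`. -/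
def Dominated (C : ℝ) (ν ϱ : StrongDual ℂ M) (h : M →ₗ[ℂ] ℂ) : Prop :=
  ∀ y x : M, ‖h (star y * x)‖ ^ 2 ≤ C * (ν (star y * y)).re * (ϱ (star x * x)).re

/-- The sum `∑ yᵢ* xᵢ` over a finite list of pairs. -/
def pairSum (l : List (M × M)) : M := (l.map fun p => star p.1 * p.2).sum

/-- Half of `∑ (ν(yᵢ* yᵢ) + ϱ(xᵢ* xᵢ))` over a finite list of pairs. -/
noncomputable def pairCost (ν ϱ : StrongDual ℂ M) (l : List (M × M)) : ℝ :=
  (l.map fun p => ((ν (star p.1 * p.1)).re + (ϱ (star p.2 * p.2)).re) / 2).sum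

/-- The infimum of the costs of all factorizations `w = ∑ yᵢ* xᵢ`. -/
noncomputable def factorNorm (ν ϱ : StrongDual ℂ M) (w : M) : ℝ :=
  sInf {r | ∃ l, pairSum l = w ∧ pairCost ν ϱ l = r}

/-- The fidelity of a pair of positive forms, whose square is the transition probability. -/
noncomputable def fidelity (ν ϱ : StrongDual ℂ M) : ℝ := factorNorm ν ϱ 1

variable {ν ϱ : StrongDual ℂ M} {h : M →ₗ[ℂ] ℂ}

theorem pairSum_append (l₁ l₂ : List (M × M)) :
    pairSum (l₁ ++ l₂) = pairSum l₁ + pairSum l₂ := by simp [pairSum]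

theorem pairCost_append (l₁ l₂ : List (M × M)) :
    pairCost ν ϱ (l₁ ++ l₂) = pairCost ν ϱ l₁ + pairCost ν ϱ l₂ := by simp [pairCost]

theorem pairSum_smul (c : ℝ) (l : List (M × M)) :
    pairSum (l.map fun p => ((c : ℂ) • p.1, (c : ℂ) • p.2)) = (c ^ 2) • pairSum l := by
  induction l with
  | nil => simp [pairSum]
  | cons p l ih =>
    simp only [pairSum, List.map_cons, List.sum_cons, smul_add] at ih ⊢
    rw [ih, star_smul, smul_mul_smul_comm, ← Complex.coe_smul (c ^ 2) (star p.1 * p.2)]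
    simp [sq]

theorem pairCost_smul (c : ℝ) (l : List (M × M)) :
    pairCost ν ϱ (l.map fun p => ((c : ℂ) • p.1, (c : ℂ) • p.2))
      = c ^ 2 * pairCost ν ϱ l := by
  induction l with
  | nil => simp [pairCost]
  | cons p l ih =>
    simp only [pairCost, List.map_cons, List.sum_cons] at ih ⊢
    have key : ∀ (f : StrongDual ℂ M) (x : M),
        (f (star ((c : ℂ) • x) * ((c : ℂ) • x))).re = c ^ 2 * (f (star x * x)).re := by
      intro f x
      rw [star_smul, smul_mul_smul_comm, map_smul, Complex.star_def, Complex.conj_ofReal,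
        ← Complex.ofReal_mul, smul_eq_mul, Complex.re_ofReal_mul, sq]
    rw [ih, key, key]
    ring

theorem norm_apply_pairSum_le (hd : ∀ y x : M,
      ‖h (star y * x)‖ ≤ ((ν (star y * y)).re + (ϱ (star x * x)).re) / 2) (l : List (M × M)) :
    ‖h (pairSum l)‖ ≤ pairCost ν ϱ l := by
  induction l with
  | nil => simp [pairSum, pairCost]
  | cons p l ih =>
    simp only [pairSum, pairCost, List.map_cons, List.sum_cons, map_add] at ih ⊢
    exact (norm_add_le _ _).trans (add_le_add (hd _ _) ih)

/-- Converts an arithmetic-mean bound, valid under all rescalings, into a Cauchy-Schwarz bound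
through the discriminant of a quadratic. -/
theorem sq_le_mul_of_forall_scaling {r A B : ℝ} (hA : 0 ≤ A) (hB : 0 ≤ B) (hr : 0 ≤ r)
    (H : ∀ t : ℝ, 0 < t → t * r ≤ (t ^ 2 * A + B) / 2) : r ^ 2 ≤ A * B := by
  have : ∀ t : ℝ, 0 ≤ A * (t * t) + (-(2 * r)) * t + B := by
    intro t
    rcases le_or_gt t 0 with ht | ht
    · nlinarith [mul_nonneg hA (mul_self_nonneg t), mul_nonneg hr (neg_nonneg.mpr ht)]
    · nlinarith [H t ht]
  have := discrim_le_zero this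
  rw [discrim] at this
  nlinarith

/-- A unimodular factor that makes a complex number nonnegative. -/
theorem exists_phase (z : ℂ) : ∃ u : ℂ, ‖u‖ = 1 ∧ u * z = ‖z‖ := by
  rcases eq_or_ne z 0 with rfl | hz
  · exact ⟨1, by simp, by simp⟩
  · refine ⟨conj z / ‖z‖, ?_, ?_⟩
    · simp [hz]
    · rw [div_mul_eq_mul_div, Complex.conj_mul', sq, mul_div_assoc, div_self, mul_one]
      exact_mod_cast norm_ne_zero_iff.mpr hz

theorem apply_star_smul_mul_self (f : StrongDual ℂ M) {u : ℂ} (hu : ‖u‖ = 1) (x : M) :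
    f (star (u • x) * (u • x)) = f (star x * x) := by
  have : star u * u = 1 := by
    rw [Complex.star_def, Complex.conj_mul', hu]; simp
  rw [star_smul, smul_mul_smul_comm, this, one_smul]

theorem apply_star_real_smul_mul_self (f : StrongDual ℂ M) (t : ℝ) (x : M) :
    (f (star ((t : ℂ) • x) * ((t : ℂ) • x))).re = t ^ 2 * (f (star x * x)).re := by
  rw [star_smul, smul_mul_smul_comm, map_smul, Complex.star_def, Complex.conj_ofReal,
    ← Complex.ofReal_mul, smul_eq_mul, Complex.re_ofReal_mul, sq]

theorem exists_pairSum_eq (w : M) : ∃ l : List (M × M), pairSum l = w :=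
  ⟨[(1, w)], by simp [pairSum]⟩

/-- Reversal of the roles of the two forms. -/
theorem Dominated.symm {C : ℝ} (hd : Dominated C ν ϱ h) :
    ∃ k : M →ₗ[ℂ] ℂ, Dominated C ϱ ν k ∧ ∀ x, k x = conj (h (star x)) := by
  refine ⟨{ toFun := fun x => conj (h (star x))
            map_add' := fun x y => by simp
            map_smul' := fun c x => by simp }, fun y x => ?_, fun x => rfl⟩
  have := hd x y
  simp only [LinearMap.coe_mk, AddHom.coe_mk, star_mul, star_star, RCLike.norm_conj]
  linarith

theorem le_factorNorm {r : ℝ} {w : M} (hr : ∀ l, pairSum l = w → r ≤ pairCost ν ϱ l) :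
    r ≤ factorNorm ν ϱ w := by
  obtain ⟨l, hl⟩ := exists_pairSum_eq w
  refine le_csInf ⟨_, l, hl, rfl⟩ ?_
  rintro _ ⟨l, hl, rfl⟩
  exact hr l hl

theorem exists_pairCost_lt {r : ℝ} {w : M} (hr : factorNorm ν ϱ w < r) :
    ∃ l, pairSum l = w ∧ pairCost ν ϱ l < r := by
  obtain ⟨l, hl⟩ := exists_pairSum_eq w
  obtain ⟨_, ⟨l, hl, rfl⟩, hlt⟩ := exists_lt_of_csInf_lt (by exact ⟨_, l, hl, rfl⟩) hr
  exact ⟨l, hl, hlt⟩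

variable [PartialOrder M] [StarOrderedRing M] {C : ℝ}

theorem Dominated.mono {ν' ϱ' : StrongDual ℂ M} (hC : 0 ≤ C) (hν : IsPositiveForm ν)
    (hϱ : IsPositiveForm ϱ) (h₁ : Subordinate ν ν') (h₂ : Subordinate ϱ ϱ')
    (hd : Dominated C ν ϱ h) : Dominated C ν' ϱ' h := fun y x =>
  (hd y x).trans (mul_le_mul (mul_le_mul_of_nonneg_left (h₁.re_le y) hC) (h₂.re_le x)
    (hϱ.re_nonneg x) (mul_nonneg hC ((hν.re_nonneg y).trans (h₁.re_le y))))

theorem pairCost_nonneg (hν : IsPositiveForm ν) (hϱ : IsPositiveForm ϱ) (l : List (M × M)) :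
    0 ≤ pairCost ν ϱ l := by
  refine List.sum_nonneg fun r hr => ?_
  obtain ⟨p, -, rfl⟩ := List.mem_map.mp hr
  have := hν.re_nonneg p.1
  have := hϱ.re_nonneg p.2
  positivity

theorem factorNorm_le_pairCost (hν : IsPositiveForm ν) (hϱ : IsPositiveForm ϱ)
    (l : List (M × M)) : factorNorm ν ϱ (pairSum l) ≤ pairCost ν ϱ l :=
  csInf_le ⟨0, by rintro _ ⟨l, -, rfl⟩; exact pairCost_nonneg hν hϱ l⟩ ⟨l, rfl, rfl⟩

theorem factorNorm_nonneg (hν : IsPositiveForm ν) (hϱ : IsPositiveForm ϱ) (w : M) :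
    0 ≤ factorNorm ν ϱ w := le_factorNorm fun l _ => pairCost_nonneg hν hϱ l

theorem factorNorm_add_le (hν : IsPositiveForm ν) (hϱ : IsPositiveForm ϱ) (v w : M) :
    factorNorm ν ϱ (v + w) ≤ factorNorm ν ϱ v + factorNorm ν ϱ w := by
  refine le_of_forall_pos_lt_add fun ε hε => ?_
  obtain ⟨l₁, rfl, h₁⟩ := exists_pairCost_lt (lt_add_of_pos_right (factorNorm ν ϱ v) (half_pos hε))
  obtain ⟨l₂, rfl, h₂⟩ := exists_pairCost_lt (lt_add_of_pos_right (factorNorm ν ϱ w) (half_pos hε))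
  have := factorNorm_le_pairCost hν hϱ (l₁ ++ l₂)
  rw [pairSum_append, pairCost_append] at this
  linarith

theorem factorNorm_smul (hν : IsPositiveForm ν) (hϱ : IsPositiveForm ϱ) {c : ℝ} (hc : 0 < c)
    (w : M) : factorNorm ν ϱ (c • w) = c * factorNorm ν ϱ w := by
  have key : ∀ {c : ℝ}, 0 < c → ∀ w, factorNorm ν ϱ (c • w) ≤ c * factorNorm ν ϱ w := by
    intro c hc w
    rw [← div_le_iff₀' hc]
    refine le_factorNorm fun l hl => ?_
    have := factorNorm_le_pairCost hν hϱ
      (l.map fun p => (((√c : ℝ) : ℂ) • p.1, ((√c : ℝ) : ℂ) • p.2))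
    rwa [pairSum_smul, pairCost_smul, Real.sq_sqrt hc.le, hl, ← div_le_iff₀' hc] at this
  refine le_antisymm (key hc w) ?_
  have := key (inv_pos.mpr hc) (c • w)
  rwa [inv_smul_smul₀ hc.ne', ← div_eq_inv_mul, le_div_iff₀' hc] at this

/-- The easy half of the duality: the geometric mean is at most the arithmetic mean, summed over a
factorization. -/
theorem Dominated.norm_le_factorNorm (hν : IsPositiveForm ν) (hϱ : IsPositiveForm ϱ)
    (hd : Dominated 1 ν ϱ h) (w : M) : ‖h w‖ ≤ factorNorm ν ϱ w := by
  refine le_factorNorm fun l hl => hl ▸ norm_apply_pairSum_le (fun y x => ?_) l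
  have h1 := hd y x
  have := hν.re_nonneg y
  have := hϱ.re_nonneg x
  refine abs_le_of_sq_le_sq' ?_ (by positivity) |>.2
  nlinarith [sq_nonneg ((ν (star y * y)).re - (ϱ (star x * x)).re)]

theorem Dominated.norm_apply_one_le (hν : IsPositiveForm ν) (hϱ : IsPositiveForm ϱ)
    (hd : Dominated 1 ν ϱ h) : ‖h 1‖ ≤ fidelity ν ϱ := hd.norm_le_factorNorm hν hϱ 1

/-- The fidelity is attained by a dominated form. -/
theorem exists_dominated_eq_fidelity (hν : IsPositiveForm ν) (hϱ : IsPositiveForm ϱ) :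
    ∃ h : M →ₗ[ℂ] ℂ, Dominated 1 ν ϱ h ∧ h 1 = fidelity ν ϱ := by
  obtain ⟨g, hg1, hg⟩ : ∃ g : M →ₗ[ℝ] ℝ, g 1 = fidelity ν ϱ ∧ ∀ w, g w ≤ factorNorm ν ϱ w := by
    -- The zero algebra is separate, since c • 1 ↦ c F is well defined on the line through 1 only if
    -- 1 ≠ 0. Otherwise Hahn-Banach extends it below the sublinear `factorNorm`.
    rcases eq_or_ne (1 : M) 0 with h10 | h10
    · refine ⟨0, ?_, fun w => factorNorm_nonneg hν hϱ w⟩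
      have := factorNorm_smul hν hϱ zero_lt_two (0 : M)
      rw [smul_zero] at this
      rw [fidelity, h10, LinearMap.zero_apply]
      linarith
    · obtain ⟨g, hg1, hg⟩ := exists_extension_of_le_sublinear
        (LinearPMap.mkSpanSingleton (1 : M) (fidelity ν ϱ) h10) (factorNorm ν ϱ)
        (fun c hc x => factorNorm_smul hν hϱ hc x) (factorNorm_add_le hν hϱ) (by
          rintro ⟨x, hx⟩
          obtain ⟨c, rfl⟩ := Submodule.mem_span_singleton.mp hx
          erw [LinearPMap.mkSpanSingleton'_apply]
          rcases le_or_gt c 0 with hc | hc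
          · exact (mul_nonpos_of_nonpos_of_nonneg hc (factorNorm_nonneg hν hϱ 1)).trans
              (factorNorm_nonneg hν hϱ _)
          · exact (factorNorm_smul hν hϱ hc 1).ge)
      refine ⟨g, ?_, hg⟩
      rw [hg1 ⟨1, Submodule.mem_span_singleton_self _⟩]
      exact LinearPMap.mkSpanSingleton_apply ℝ ℝ h10 (fidelity ν ϱ)
  let h : M →ₗ[ℂ] ℂ := Module.Dual.extendRCLike (𝕜 := ℂ) g
  have hre : ∀ w, (h w).re = g w := fun w => Module.Dual.re_extendRCLike_apply (𝕜 := ℂ) g w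
  have hd : Dominated 1 ν ϱ h := by
    intro y x
    rw [one_mul]
    refine sq_le_mul_of_forall_scaling (hν.re_nonneg y) (hϱ.re_nonneg x) (norm_nonneg _) ?_
    intro t ht
    -- The phase u makes h(y*x) nonnegative, and scaling y by t yields the family of bounds required
    -- by the discriminant argument.
    obtain ⟨u, hu, hu'⟩ := exists_phase (h (star y * x))
    have h1 := hg (pairSum [((t : ℂ) • y, u • x)])
    have h2 := h1.trans (factorNorm_le_pairCost hν hϱ _)
    rw [← hre] at h2
    simp only [pairSum, pairCost, List.map_cons, List.map_nil, List.sum_cons, List.sum_nil,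
      add_zero] at h2
    rw [apply_star_smul_mul_self ϱ hu, apply_star_real_smul_mul_self, star_smul,
      smul_mul_smul_comm, map_smul, smul_eq_mul, mul_assoc, hu', Complex.star_def,
      Complex.conj_ofReal, ← Complex.ofReal_mul, Complex.ofReal_re] at h2
    exact h2
  refine ⟨h, hd, ?_⟩
  have h1 : (h 1).re = fidelity ν ϱ := by rw [hre, hg1]
  have h2 := hd.norm_apply_one_le hν hϱ
  -- A number whose real part F is at least its modulus is real.
  have h3 : 0 ≤ h 1 := by
    rw [← Complex.re_eq_norm]
    exact le_antisymm (Complex.re_le_norm _) (h1 ▸ h2)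
  have h4 := (Complex.nonneg_iff.mp h3).2
  apply Complex.ext <;> simp [h1, ← h4]

theorem fidelity_nonneg (hν : IsPositiveForm ν) (hϱ : IsPositiveForm ϱ) : 0 ≤ fidelity ν ϱ :=
  factorNorm_nonneg hν hϱ 1

theorem fidelity_eq_zero_iff (hν : IsPositiveForm ν) (hϱ : IsPositiveForm ϱ) :
    fidelity ν ϱ = 0 ↔ ∀ h, Dominated 1 ν ϱ h → h 1 = 0 := by
  constructor
  · intro h0 h hd
    exact norm_le_zero_iff.mp (h0 ▸ hd.norm_apply_one_le hν hϱ)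
  · intro H
    obtain ⟨h, hd, h1⟩ := exists_dominated_eq_fidelity hν hϱ
    rw [H h hd] at h1
    exact_mod_cast h1.symm

theorem fidelity_comm (hν : IsPositiveForm ν) (hϱ : IsPositiveForm ϱ) :
    fidelity ν ϱ = fidelity ϱ ν := by
  have key : ∀ {ν ϱ : StrongDual ℂ M}, IsPositiveForm ν → IsPositiveForm ϱ →
      fidelity ν ϱ ≤ fidelity ϱ ν := by
    intro ν ϱ hν hϱ
    obtain ⟨h, hd, h1⟩ := exists_dominated_eq_fidelity hν hϱ
    obtain ⟨k, hk, hkh⟩ := hd.symm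
    have := hk.norm_apply_one_le hϱ hν
    rwa [hkh, star_one, h1, RCLike.norm_conj, Complex.norm_real,
      Real.norm_of_nonneg (fidelity_nonneg hν hϱ)] at this
  exact le_antisymm (key hν hϱ) (key hϱ hν)

theorem fidelity_mono {ν' ϱ' : StrongDual ℂ M} (hν : IsPositiveForm ν)
    (hϱ : IsPositiveForm ϱ) (hν' : IsPositiveForm ν') (hϱ' : IsPositiveForm ϱ')
    (h₁ : Subordinate ν ν') (h₂ : Subordinate ϱ ϱ') : fidelity ν ϱ ≤ fidelity ν' ϱ' := by
  obtain ⟨h, hd, h1⟩ := exists_dominated_eq_fidelity hν hϱ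
  have := (hd.mono zero_le_one hν hϱ h₁ h₂).norm_apply_one_le hν' hϱ'
  rwa [h1, Complex.norm_real, Real.norm_of_nonneg (fidelity_nonneg hν hϱ)] at this

end Dominated

/-! ### Orthogonality as vanishing fidelity -/

section Orthogonality

variable {M : Type u} [CStarAlgebra M] {ν ϱ : StrongDual ℂ M} {h : M →ₗ[ℂ] ℂ}

theorem Dominated.norm_sq_apply_one_le [PartialOrder M] [StarOrderedRing M]
    (hν : IsPositiveForm ν) (hϱ : IsPositiveForm ϱ) {C : ℝ} (hC : 0 ≤ C)
    (hd : Dominated C ν ϱ h) : ‖h 1‖ ^ 2 ≤ C * fidelity ν ϱ ^ 2 := by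
  rcases hC.eq_or_lt with rfl | hC
  · have := hd 1 1
    simpa using this
  · have hC' : (0 : ℝ) < √C := Real.sqrt_pos.mpr hC
    have hd' : Dominated 1 ν ϱ ((((√C)⁻¹ : ℝ) : ℂ) • h) := by
      intro y x
      rw [LinearMap.smul_apply, norm_smul, Complex.norm_real, mul_pow, Real.norm_eq_abs, sq_abs,
        inv_pow, Real.sq_sqrt hC.le, one_mul, inv_mul_le_iff₀ hC, ← mul_assoc]
      exact hd y x
    have := hd'.norm_apply_one_le hν hϱ
    rw [LinearMap.smul_apply, norm_smul, Complex.norm_real, Real.norm_eq_abs,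
      abs_of_pos (inv_pos.mpr hC'), inv_mul_le_iff₀ hC'] at this
    calc ‖h 1‖ ^ 2 ≤ (√C * fidelity ν ϱ) ^ 2 := by gcongr
      _ = C * fidelity ν ϱ ^ 2 := by rw [mul_pow, Real.sq_sqrt hC.le]

theorem pairCost_eq (l : List (M × M)) :
    pairCost ν ϱ l = ((ν (pairSum (l.map fun p => (p.1, p.1)))).re +
      (ϱ (pairSum (l.map fun p => (p.2, p.2)))).re) / 2 := by
  induction l with
  | nil => simp [pairSum, pairCost]
  | cons p l ih =>
    simp only [pairSum, pairCost, List.map_cons, List.sum_cons] at ih ⊢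
    rw [ih]
    simp only [map_add, Complex.add_re]
    ring

theorem pairSum_shift (d : M) (l : List (M × M)) :
    pairSum (l.map fun p => (p.2 - p.1 * d, p.2 - p.1 * d)) =
      pairSum (l.map fun p => (p.2, p.2)) - star (pairSum l) * d - star d * pairSum l
        + star d * pairSum (l.map fun p => (p.1, p.1)) * d := by
  induction l with
  | nil => simp [pairSum]
  | cons p l ih =>
    simp only [pairSum, List.map_cons, List.sum_cons] at ih ⊢
    rw [ih]
    simp only [star_sub, star_mul, star_add, star_star]
    noncomm_ring

variable [PartialOrder M] [StarOrderedRing M]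

theorem pairSum_diag_nonneg (l : List M) : 0 ≤ pairSum (l.map fun x => (x, x)) := by
  induction l with
  | nil => simp [pairSum]
  | cons p l ih =>
    simp only [pairSum, List.map_cons, List.sum_cons] at ih ⊢
    exact add_nonneg (star_mul_self_nonneg p) ih

theorem IsPositiveForm.apply_star (hν : IsPositiveForm ν) (x : M) : ν (star x) = conj (ν x) := by
  obtain ⟨K, _, _, _, π, η, rfl, -⟩ := hν.exists_cyclic
  rw [vectorForm_apply, vectorForm_apply, inner_conj_symm, inner_rep_left]

/-- A factorization of `1` of small cost yields an element of the unit ball on which `ν - ϱ` almost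
attains `‖ν‖ + ‖ϱ‖`. -/
theorem exists_norm_le_one_of_pairSum_eq_one (hν : IsPositiveForm ν) (hϱ : IsPositiveForm ϱ)
    {l : List (M × M)} (hl : pairSum l = 1) :
    ∃ t : M, ‖t‖ ≤ 1 ∧ (ν 1).re + (ϱ 1).re - 4 * pairCost ν ϱ l ≤ ((ν - ϱ) t).re := by
  -- With a = ∑ yᵢ*yᵢ, b = ∑ xᵢ*xᵢ and d = (1 + a)⁻¹, the aim is 1 - d ≤ a and d ≤ b, so that ν is
  -- small on 1 - d and ϱ is small on d.
  set a := pairSum (l.map fun p => (p.1, p.1)) with ha_def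
  set b := pairSum (l.map fun p => (p.2, p.2)) with hb_def
  have ha : 0 ≤ a := by
    have := pairSum_diag_nonneg (l.map Prod.fst)
    rwa [List.map_map] at this
  have hu : IsUnit (1 + a) :=
    CStarAlgebra.isUnit_of_le (1 : M) (le_add_of_nonneg_right ha) isStrictlyPositive_one
  obtain ⟨U, hU⟩ := hu
  set d : M := ↑U⁻¹ with hd_def
  have h1 : (1 + a) * d = 1 := by rw [← hU]; exact U.mul_inv
  have h2 : d * (1 + a) = 1 := by rw [← hU]; exact U.inv_mul
  have had : a * d = 1 - d := by rw [eq_sub_iff_add_eq', ← h1]; noncomm_ring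
  have hda : d * a = 1 - d := by rw [eq_sub_iff_add_eq', ← h2]; noncomm_ring
  have hasa : star a = a := (IsSelfAdjoint.of_nonneg ha).star_eq
  have hds : star d = d := by
    have h3 : star d * (1 + a) = 1 := by
      have := congrArg star h1
      rwa [star_mul, star_add, star_one, hasa] at this
    calc star d = star d * ((1 + a) * d) := by rw [h1, mul_one]
      _ = d := by rw [← mul_assoc, h3, one_mul]
  have hdad : d * a * d = d - d * d := by rw [hda, sub_mul, one_mul]
  -- Since ∑ yᵢ*xᵢ = 1, expanding 0 ≤ ∑ (xᵢ - yᵢd)*(xᵢ - yᵢd) gives 0 ≤ b - 2d + dad = b - d - d².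
  have hdle : d ≤ b := by
    have h4 := pairSum_diag_nonneg (l.map fun p => p.2 - p.1 * d)
    rw [List.map_map] at h4
    have h5 : (0 : M) ≤ _ := h4.trans_eq (pairSum_shift d l)
    rw [hl, star_one, one_mul, mul_one, hds, ← ha_def, ← hb_def, hdad] at h5
    have h6 : 0 ≤ d * d := by
      have := star_mul_self_nonneg d
      rwa [hds] at this
    rw [← sub_nonneg]
    have : b - d = (b - d - d + (d - d * d)) + d * d := by abel
    rw [this]
    exact add_nonneg h5 h6
  have hdge : 1 - d ≤ a := by
    have h7 : 0 ≤ star (1 - d) * (1 + a) * (1 - d) :=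
      star_left_conjugate_nonneg (add_nonneg zero_le_one ha) _
    rw [star_sub, star_one, hds, sub_mul, h2, one_mul, mul_sub, mul_one, add_sub_cancel_left,
      had] at h7
    exact sub_nonneg.mp h7
  -- For t = 2d - 1, t*t = 1 - 4dad ≤ 1, and (ν - ϱ)(t) = ν(1) + ϱ(1) - 2ν(1 - d) - 2ϱ(d).
  refine ⟨d - (1 - d), ?_, ?_⟩
  · have h8 : star (d - (1 - d)) * (d - (1 - d)) = 1 - (4 : ℝ) • (d * a * d) := by
      rw [hdad, star_sub, star_sub, star_one, hds]
      have : (4 : ℝ) • (d - d * d) = 4 * (d - d * d) := by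
        rw [← Nat.cast_ofNat (R := ℝ), Nat.cast_smul_eq_nsmul, nsmul_eq_mul]; simp
      rw [this]
      noncomm_ring
    have h9 : 0 ≤ d * a * d := by
      have := star_left_conjugate_nonneg ha d
      rwa [hds] at this
    have h10 : ‖star (d - (1 - d)) * (d - (1 - d))‖ ≤ 1 := by
      rw [CStarAlgebra.norm_le_one_iff_of_nonneg _ (star_mul_self_nonneg _), h8]
      exact sub_le_self _ (smul_nonneg (by norm_num) h9)
    rw [CStarRing.norm_star_mul_self] at h10
    nlinarith [norm_nonneg (d - (1 - d))]
  · have h11 := hν.mono hdge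
    have h12 := hϱ.mono hdle
    rw [pairCost_eq, ← ha_def, ← hb_def]
    simp only [sub_apply, map_sub, Complex.sub_re] at h11 ⊢
    linarith

theorem orthogonal_of_fidelity_eq_zero (hν : IsPositiveForm ν) (hϱ : IsPositiveForm ϱ)
    (h0 : fidelity ν ϱ = 0) : Orthogonal ν ϱ := by
  refine le_antisymm (norm_sub_le _ _) (le_of_forall_pos_le_add fun ε hε => ?_)
  obtain ⟨l, hl, hlt⟩ := exists_pairCost_lt (show factorNorm ν ϱ 1 < ε / 4 by
    rw [← fidelity, h0]; positivity)
  obtain ⟨t, ht, hle⟩ := exists_norm_le_one_of_pairSum_eq_one hν hϱ hl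
  have h1 := (Complex.re_le_norm _).trans ((ν - ϱ).le_opNorm t)
  have h2 := mul_le_of_le_one_right (norm_nonneg (ν - ϱ)) ht
  rw [hν.norm_eq, hϱ.norm_eq]
  linarith

/-- A self-adjoint s in the unit ball that almost attains the norm makes ν(1 - s) and ϱ(1 + s) at
most ε. In 2h(1) = h(1 - s) + h(1 + s), domination then makes each summand small. -/
theorem Orthogonal.fidelity_eq_zero (hν : IsPositiveForm ν) (hϱ : IsPositiveForm ϱ)
    (ho : Orthogonal ν ϱ) : fidelity ν ϱ = 0 := by
  rw [fidelity_eq_zero_iff hν hϱ]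
  intro h hd
  have key : ∀ ε : ℝ, 0 < ε → ‖h 1‖ ^ 2 ≤ ε * ((ν 1).re + (ϱ 1).re) := by
    intro ε hε
    obtain ⟨x, hx, hxε⟩ := (ν - ϱ).exists_lt_apply_of_lt_opNorm (sub_lt_self _ hε)
    obtain ⟨u, hu, hux⟩ := exists_phase ((ν - ϱ) x)
    set w := u • x with hw
    have hfw : (ν - ϱ) w = ‖(ν - ϱ) x‖ := by rw [hw, map_smul, smul_eq_mul, hux]
    have hwn : ‖w‖ ≤ 1 := by rw [hw, norm_smul, hu, one_mul]; exact hx.le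
    -- Hermitian forms take the same real part on w and on its self-adjoint part.
    set s : M := (2⁻¹ : ℝ) • (w + star w) with hs
    have hsn : ‖s‖ ≤ 1 := by
      rw [hs, norm_smul, Real.norm_of_nonneg (by norm_num)]
      have := norm_add_le w (star w)
      rw [norm_star] at this
      linarith
    have hssa : IsSelfAdjoint s := (IsSelfAdjoint.all (2⁻¹ : ℝ)).smul (IsSelfAdjoint.add_star_self w)
    have hfs : ((ν - ϱ) s).re = ‖(ν - ϱ) x‖ := by
      have hstar : (ν - ϱ) (star w) = conj ((ν - ϱ) w) := by
        simp only [sub_apply, hν.apply_star, hϱ.apply_star, map_sub]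
      rw [hs, ← Complex.coe_smul, map_smul, map_add, hstar, hfw, Complex.conj_ofReal, smul_eq_mul,
        ← Complex.ofReal_add, ← Complex.ofReal_mul, Complex.ofReal_re]
      ring
    have hle : algebraMap ℝ M ‖s‖ ≤ 1 := by
      rw [← map_one (algebraMap ℝ M)]
      exact algebraMap_mono M hsn
    have hs1 : 0 ≤ 1 - s := sub_nonneg.mpr (hssa.le_algebraMap_norm_self.trans hle)
    have hs2 : 0 ≤ 1 + s := by
      have := (neg_le_neg hle).trans hssa.neg_algebraMap_norm_le_self
      rwa [neg_le_iff_add_nonneg, add_comm] at this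
    obtain ⟨y, hy⟩ := CStarAlgebra.nonneg_iff_eq_star_mul_self.mp hs1
    obtain ⟨z, hz⟩ := CStarAlgebra.nonneg_iff_eq_star_mul_self.mp hs2
    have e1 := hd y y
    have e2 := hd z z
    have p1 := hν.re_nonneg y
    have p2 := hν.re_nonneg z
    have p3 := hϱ.re_nonneg y
    have p4 := hϱ.re_nonneg z
    rw [← hy] at e1 p1 p3
    rw [← hz] at e2 p2 p4
    unfold Orthogonal at ho
    rw [ho, hν.norm_eq, hϱ.norm_eq, ← hfs] at hxε
    have e3 : h 1 = (h (1 - s) + h (1 + s)) / 2 := by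
      rw [map_sub, map_add]; ring
    have e4 : ‖h 1‖ ≤ (‖h (1 - s)‖ + ‖h (1 + s)‖) / 2 := by
      rw [e3, norm_div, Complex.norm_two]
      gcongr
      exact norm_add_le _ _
    have e5 : ‖h 1‖ ^ 2 ≤ (‖h (1 - s)‖ ^ 2 + ‖h (1 + s)‖ ^ 2) / 2 := by
      have := pow_le_pow_left₀ (norm_nonneg _) e4 2
      nlinarith [sq_nonneg (‖h (1 - s)‖ - ‖h (1 + s)‖)]
    simp only [map_sub, map_add, sub_apply, Complex.sub_re, Complex.add_re] at *
    have q1 : (ν 1).re - (ν s).re ≤ ε := by linarith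
    have q2 : (ϱ 1).re + (ϱ s).re ≤ ε := by linarith
    have q3 : (ϱ 1).re - (ϱ s).re ≤ 2 * (ϱ 1).re := by linarith
    have q4 : (ν 1).re + (ν s).re ≤ 2 * (ν 1).re := by linarith
    have r1 := mul_le_mul q1 q3 p3 hε.le
    have r2 := mul_le_mul q4 q2 p4 (p2.trans q4)
    linarith
  have hlim : Filter.Tendsto (fun ε : ℝ => ε * ((ν 1).re + (ϱ 1).re))
      (nhdsWithin 0 (Set.Ioi 0)) (nhds 0) := by
    have : Filter.Tendsto (fun ε : ℝ => ε * ((ν 1).re + (ϱ 1).re)) (nhds 0)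
        (nhds (0 * ((ν 1).re + (ϱ 1).re))) := by
      exact (continuous_id.mul continuous_const).tendsto 0
    rw [zero_mul] at this
    exact this.mono_left nhdsWithin_le_nhds
  have h0 : ‖h 1‖ ^ 2 ≤ 0 :=
    ge_of_tendsto hlim (Filter.eventually_of_mem self_mem_nhdsWithin fun ε hε => key ε hε)
  exact norm_eq_zero.mp (pow_eq_zero_iff two_ne_zero |>.mp (le_antisymm h0 (sq_nonneg _)))

theorem orthogonal_iff (hν : IsPositiveForm ν) (hϱ : IsPositiveForm ϱ) :
    Orthogonal ν ϱ ↔ fidelity ν ϱ = 0 :=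
  ⟨fun h => h.fidelity_eq_zero hν hϱ, orthogonal_of_fidelity_eq_zero hν hϱ⟩

/-- The first-order term 2tpr cannot be absorbed by second-order terms; for p = 0 the bound itself
gives r = 0. This is the engine of both perturbation arguments. -/
theorem eq_zero_of_forall_sq_le {p r B : ℝ}
    (H : ∀ t : ℝ, (p + t * r) ^ 2 ≤ (1 + t ^ 2 * B) * p ^ 2) : r = 0 := by
  rcases eq_or_ne p 0 with rfl | hp
  · have := H 1
    nlinarith
  · have : ∀ t : ℝ, 0 ≤ (B * p ^ 2 - r ^ 2) * (t * t) + (-(2 * p * r)) * t + 0 := by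
      intro t
      nlinarith [H t]
    have := discrim_le_zero this
    rw [discrim] at this
    have h2 : (p * r) ^ 2 = 0 := le_antisymm (by nlinarith) (sq_nonneg _)
    exact (mul_eq_zero.mp (pow_eq_zero_iff two_ne_zero |>.mp h2)).resolve_left hp

theorem eq_zero_of_forall_norm_sq_le {p B : ℝ} {z : ℂ}
    (H : ∀ u : ℂ, ‖(p : ℂ) + u * z‖ ^ 2 ≤ (1 + ‖u‖ ^ 2 * B) * p ^ 2) : z = 0 := by
  obtain ⟨v, hv, hvz⟩ := exists_phase z
  rw [← norm_eq_zero]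
  refine eq_zero_of_forall_sq_le (p := p) (B := B) fun t => ?_
  have := H (t * v)
  rwa [mul_assoc, hvz, ← Complex.ofReal_mul, ← Complex.ofReal_add, Complex.norm_real, norm_mul,
    hv, mul_one, Complex.norm_real, Real.norm_eq_abs, Real.norm_eq_abs, sq_abs, sq_abs] at this

/-- A subordinate form with the same fidelity differs by a form orthogonal to `ν`. -/
theorem fidelity_sub_eq_zero {ϱ' : StrongDual ℂ M} (hν : IsPositiveForm ν)
    (hϱ : IsPositiveForm ϱ) (hϱ' : IsPositiveForm ϱ') (hs : Subordinate ϱ' ϱ)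
    (hf : fidelity ν ϱ' = fidelity ν ϱ) : fidelity ν (ϱ - ϱ') = 0 := by
  rw [fidelity_eq_zero_iff hν hs]
  intro k hk
  obtain ⟨h, hd, h1⟩ := exists_dominated_eq_fidelity hν hϱ'
  refine eq_zero_of_forall_norm_sq_le (p := fidelity ν ϱ) (B := 1) fun u => ?_
  -- Cauchy-Schwarz for the vectors (1, |u|) and (√ϱ'(x*x), √(ϱ - ϱ')(x*x)) gives the constant 1 +
  -- |u|².
  have hdu : Dominated (1 + ‖u‖ ^ 2 * 1) ν ϱ (h + u • k) := by
    intro y x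
    have e1 := hd y x
    have e2 := hk y x
    rw [one_mul, sub_apply, Complex.sub_re] at *
    have e3 : ‖(h + u • k) (star y * x)‖ ≤ ‖h (star y * x)‖ + ‖u‖ * ‖k (star y * x)‖ := by
      rw [LinearMap.add_apply, LinearMap.smul_apply, ← norm_smul]
      exact norm_add_le _ _
    have e4 := pow_le_pow_left₀ (norm_nonneg _) e3 2
    nlinarith [sq_nonneg (‖u‖ * ‖h (star y * x)‖ - ‖k (star y * x)‖), sq_nonneg ‖u‖,
      mul_le_mul_of_nonneg_left e1 (sq_nonneg ‖u‖), mul_le_mul_of_nonneg_left e2 (sq_nonneg ‖u‖)]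
  have := hdu.norm_sq_apply_one_le hν hϱ (by positivity)
  rwa [LinearMap.add_apply, LinearMap.smul_apply, h1, hf, smul_eq_mul] at this

end Orthogonality

/-! ### Dominated and subordinate forms in cyclic representations -/

section VectorImplementation

variable {M : Type u} [CStarAlgebra M]
variable {K : Type u} [NormedAddCommGroup K] [InnerProductSpace ℂ K] [CompleteSpace K]
  {K' : Type u} [NormedAddCommGroup K'] [InnerProductSpace ℂ K'] [CompleteSpace K']
  (π : M →⋆ₐ[ℂ] (K →L[ℂ] K)) (π' : M →⋆ₐ[ℂ] (K' →L[ℂ] K'))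

/-- The linear form `x ↦ ⟨ζ, π(x)η⟩`. -/
noncomputable def pairForm (ζ η : K) : M →ₗ[ℂ] ℂ where
  toFun x := ⟪ζ, π x η⟫_ℂ
  map_add' x y := by simp
  map_smul' c x := by simp

@[simp]
theorem pairForm_apply (ζ η : K) (x : M) : pairForm π ζ η x = ⟪ζ, π x η⟫_ℂ := rfl

variable {ν ϱ τ : StrongDual ℂ M} {h : M →ₗ[ℂ] ℂ} {C : ℝ} {π π'}

theorem dominated_pairForm {ζ η : K} (hζ : ∀ y, ‖π y ζ‖ ^ 2 ≤ C * (ν (star y * y)).re)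
    (hη : ∀ x, ‖π x η‖ ^ 2 ≤ (ϱ (star x * x)).re) : Dominated C ν ϱ (pairForm π ζ η) := by
  intro y x
  rw [pairForm_apply, inner_rep_star_mul]
  calc ‖⟪π y ζ, π x η⟫_ℂ‖ ^ 2 ≤ (‖π y ζ‖ * ‖π x η‖) ^ 2 := by gcongr; exact norm_inner_le_norm _ _
    _ = ‖π y ζ‖ ^ 2 * ‖π x η‖ ^ 2 := mul_pow _ _ _
    _ ≤ _ := mul_le_mul (hζ y) (hη x) (sq_nonneg _) ((sq_nonneg _).trans (hζ y))

theorem norm_rep_sq {η : K} (hη : vectorForm π η = ϱ) (x : M) :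
    ‖π x η‖ ^ 2 = (ϱ (star x * x)).re := by
  rw [← hη, vectorForm_apply, inner_rep_star_mul_self]

variable [PartialOrder M] [StarOrderedRing M]

/-- A dominated form is implemented by a vector of any cyclic representation for `ϱ`. -/
theorem Dominated.exists_vector (hν : IsPositiveForm ν) (hC : 0 ≤ C) (hd : Dominated C ν ϱ h)
    {η : K} (hη : vectorForm π η = ϱ) (hcyc : DenseRange (orbit π η)) :
    ∃ ζ : K, (∀ x, h x = ⟪ζ, π x η⟫_ℂ) ∧ ∀ y, ‖π y ζ‖ ^ 2 ≤ C * (ν (star y * y)).re := by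
  have hbound : ∀ y x, ‖h (star y * x)‖ ≤ √(C * (ν (star y * y)).re) * ‖orbit π η x‖ := by
    intro y x
    refine Real.le_sqrt_of_sq_le (hd y x) |>.trans_eq ?_
    rw [Real.sqrt_mul (mul_nonneg hC (hν.re_nonneg y)), ← norm_rep_sq hη, orbit_apply,
      Real.sqrt_sq (norm_nonneg _)]
  have hb1 : ∃ B, ∀ x, ‖h x‖ ≤ B * ‖orbit π η x‖ := ⟨_, fun x => by simpa using hbound 1 x⟩
  -- The bound lets h descend to a continuous functional of π(x)η; ζ is its Riesz vector.
  set T := h.extendOfNorm (orbit π η) with hT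
  have hTx : ∀ x, ⟪(toDual ℂ K).symm T, π x η⟫_ℂ = h x := by
    intro x
    rw [toDual_symm_apply]
    exact LinearMap.extendOfNorm_eq hcyc hb1 x
  refine ⟨(toDual ℂ K).symm T, fun x => (hTx x).symm, fun y => ?_⟩
  set ζ := (toDual ℂ K).symm T
  have hall : ∀ v : K, ‖⟪π y ζ, v⟫_ℂ‖ ≤ √(C * (ν (star y * y)).re) * ‖v‖ := by
    refine hcyc.induction ?_ (isClosed_le (by fun_prop) (by fun_prop))
    rintro _ ⟨x, rfl⟩
    have := hbound y x
    rwa [← hTx, inner_rep_star_mul] at this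
  have h1 := hall (π y ζ)
  rw [inner_self_eq_norm_sq_to_K, norm_pow, RCLike.norm_ofReal, abs_norm] at h1
  have h2 : ‖π y ζ‖ ≤ √(C * (ν (star y * y)).re) := by
    rcases eq_or_lt_of_le (norm_nonneg (π y ζ)) with h0 | h0
    · rw [← h0]; exact Real.sqrt_nonneg _
    · rw [sq] at h1; exact le_of_mul_le_mul_right h1 h0
  have := pow_le_pow_left₀ (norm_nonneg _) h2 2
  rwa [Real.sq_sqrt (mul_nonneg hC (hν.re_nonneg y))] at this

/-- A subordinate form is implemented through a contraction that intertwines the cyclic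
representations. -/
theorem exists_intertwiner (hs : Subordinate τ ϱ) {η : K}
    (hη : vectorForm π η = ϱ) (hcyc : DenseRange (orbit π η)) {η' : K'}
    (hη' : vectorForm π' η' = τ) :
    ∃ V : K →L[ℂ] K', V η = η' ∧ (∀ a v, V (π a v) = π' a (V v)) ∧ ∀ v, ‖V v‖ ≤ ‖v‖ := by
  have hb : ∀ x, ‖orbit π' η' x‖ ≤ 1 * ‖orbit π η x‖ := by
    intro x
    rw [one_mul, orbit_apply, orbit_apply, ← sq_le_sq₀ (norm_nonneg _) (norm_nonneg _),
      norm_rep_sq hη, norm_rep_sq hη']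
    exact hs.re_le x
  have hV : ∀ x, (orbit π' η').extendOfNorm (orbit π η) (π x η) = π' x η' := fun x =>
    LinearMap.extendOfNorm_eq hcyc ⟨1, hb⟩ x
  refine ⟨(orbit π' η').extendOfNorm (orbit π η), ?_, fun a => ?_, fun v => ?_⟩
  · have := hV 1
    rwa [rep_one_apply, rep_one_apply] at this
  · refine hcyc.induction ?_ (isClosed_eq (by fun_prop) (by fun_prop))
    rintro _ ⟨x, rfl⟩
    rw [orbit_apply, ← rep_mul_apply, hV, hV, rep_mul_apply]
  · simpa using LinearMap.norm_extendOfNorm_apply_le hcyc 1 hb v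

end VectorImplementation

/-! ### Direct sums of representations -/

section DirectSum

variable {M : Type u} [CStarAlgebra M]
variable {K : Type u} [NormedAddCommGroup K] [InnerProductSpace ℂ K] [CompleteSpace K]
  {K' : Type u} [NormedAddCommGroup K'] [InnerProductSpace ℂ K'] [CompleteSpace K']

/-- The direct sum of two operators. -/
noncomputable def directSumOp (a : K →L[ℂ] K) (b : K' →L[ℂ] K') :
    WithLp 2 (K × K') →L[ℂ] WithLp 2 (K × K') :=
  ((WithLp.prodContinuousLinearEquiv 2 ℂ K K').symm : K × K' →L[ℂ] WithLp 2 (K × K')) ∘L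
    (a.prodMap b) ∘L (WithLp.prodContinuousLinearEquiv 2 ℂ K K' : WithLp 2 (K × K') →L[ℂ] K × K')

omit [CompleteSpace K] [CompleteSpace K'] in
@[simp]
theorem directSumOp_apply (a : K →L[ℂ] K) (b : K' →L[ℂ] K') (v : WithLp 2 (K × K')) :
    directSumOp a b v = WithLp.toLp 2 (a v.fst, b v.snd) := rfl

/-- The direct sum of two representations. -/
noncomputable def directSumRep (π : M →⋆ₐ[ℂ] (K →L[ℂ] K)) (π' : M →⋆ₐ[ℂ] (K' →L[ℂ] K')) :
    M →⋆ₐ[ℂ] (WithLp 2 (K × K') →L[ℂ] WithLp 2 (K × K')) where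
  toFun x := directSumOp (π x) (π' x)
  map_one' := by ext v; simp; rfl
  map_mul' x y := by ext v; simp
  map_zero' := by ext v; simp
  map_add' x y := by ext v; simp; rfl
  commutes' r := by ext v; simp [Algebra.algebraMap_eq_smul_one]; rfl
  map_star' x := by
    rw [ContinuousLinearMap.star_eq_adjoint, ContinuousLinearMap.eq_adjoint_iff]
    intro v w
    simp only [WithLp.prod_inner_apply, directSumOp_apply]
    rw [inner_rep_left, inner_rep_left, star_star]
    rfl

theorem directSumRep_apply (π : M →⋆ₐ[ℂ] (K →L[ℂ] K)) (π' : M →⋆ₐ[ℂ] (K' →L[ℂ] K')) (x : M)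
    (v : WithLp 2 (K × K')) :
    directSumRep π π' x v = WithLp.toLp 2 (π x v.fst, π' x v.snd) := rfl

end DirectSum

/-! ### Bures distance and transition probability through the fidelity -/

section Distance

variable {M : Type u} [CStarAlgebra M] [PartialOrder M] [StarOrderedRing M]
variable {K : Type u} [NormedAddCommGroup K] [InnerProductSpace ℂ K] [CompleteSpace K]
  {ν ϱ : StrongDual ℂ M} {h : M →ₗ[ℂ] ℂ}

omit [PartialOrder M] [StarOrderedRing M] in
theorem mem_fibre_iff {π : M →⋆ₐ[ℂ] (K →L[ℂ] K)} {χ : K} :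
    χ ∈ fibre π ν ↔ vectorForm π χ = ν :=
  ⟨fun hχ => ContinuousLinearMap.ext fun x => (hχ x).symm, fun hχ x => by rw [← hχ]; rfl⟩

omit [PartialOrder M] [StarOrderedRing M] in
theorem norm_sq_of_mem_fibre {π : M →⋆ₐ[ℂ] (K →L[ℂ] K)} {χ : K} (hχ : χ ∈ fibre π ν) :
    ‖χ‖ ^ 2 = (ν 1).re := by
  rw [hχ 1, rep_one_apply]; exact (inner_self_eq_norm_sq (𝕜 := ℂ) _).symm

theorem Implements.norm_inner_le (hν : IsPositiveForm ν) (hϱ : IsPositiveForm ϱ) {φ ψ : K}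
    (hi : Implements ν ϱ φ ψ) : ‖⟪φ, ψ⟫_ℂ‖ ≤ fidelity ν ϱ := by
  obtain ⟨π, hφ, hψ⟩ := hi
  have hd : Dominated 1 ν ϱ (pairForm π φ ψ) := dominated_pairForm
    (fun y => by rw [one_mul, norm_rep_sq (mem_fibre_iff.mp hφ)])
    (fun x => (norm_rep_sq (mem_fibre_iff.mp hψ) x).le)
  have := hd.norm_apply_one_le hν hϱ
  rwa [pairForm_apply, rep_one_apply] at this

omit [PartialOrder M] [StarOrderedRing M] in
theorem Implements.norm_sub_sq {φ ψ : K} (hi : Implements ν ϱ φ ψ) :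
    ‖ψ - φ‖ ^ 2 = (ν 1).re + (ϱ 1).re - 2 * (⟪φ, ψ⟫_ℂ).re := by
  obtain ⟨π, hφ, hψ⟩ := hi
  rw [norm_sub_rev, _root_.norm_sub_sq (𝕜 := ℂ), norm_sq_of_mem_fibre hφ, norm_sq_of_mem_fibre hψ]
  simp only [RCLike.re_to_complex]
  ring

/-- The vector ζ of an optimal form only implements a form below ν. The deficit is implemented in a
second summand, where the vector for ϱ is zero, so the inner product is unaffected. -/
theorem exists_implements_eq_fidelity (hν : IsPositiveForm ν) (hϱ : IsPositiveForm ϱ) :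
    ∃ (K : Type u) (_ : NormedAddCommGroup K) (_ : InnerProductSpace ℂ K) (_ : CompleteSpace K)
      (φ ψ : K), Implements ν ϱ φ ψ ∧ ⟪φ, ψ⟫_ℂ = fidelity ν ϱ := by
  obtain ⟨h, hd, h1⟩ := exists_dominated_eq_fidelity hν hϱ
  obtain ⟨K, _, _, _, π, η, hη, hcyc⟩ := hϱ.exists_cyclic
  obtain ⟨ζ, hζ, hζν⟩ := hd.exists_vector hν zero_le_one hη hcyc
  have hsub : Subordinate (vectorForm π ζ) ν := by
    rw [subordinate_iff (isPositiveForm_vectorForm π ζ) hν]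
    intro x
    rw [← norm_rep_sq rfl, ← one_mul (ν _).re]
    exact hζν x
  obtain ⟨K', _, _, _, π', η', hη', -⟩ := IsPositiveForm.exists_cyclic hsub
  refine ⟨WithLp 2 (K × K'), inferInstance, inferInstance, inferInstance,
    WithLp.toLp 2 (ζ, η'), WithLp.toLp 2 (η, 0), ⟨directSumRep π π', fun x => ?_, fun x => ?_⟩, ?_⟩
  · have := DFunLike.congr_fun hη' x
    rw [sub_apply, vectorForm_apply, vectorForm_apply, eq_sub_iff_add_eq'] at this
    rw [← this, WithLp.prod_inner_apply, directSumRep_apply]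
    rfl
  · rw [WithLp.prod_inner_apply, directSumRep_apply, ← hη]
    simp
  · rw [WithLp.prod_inner_apply, ← h1, hζ, rep_one_apply]
    simp

theorem transitionProb_eq (hν : IsPositiveForm ν) (hϱ : IsPositiveForm ϱ) :
    transitionProb ν ϱ = fidelity ν ϱ ^ 2 := by
  refine IsGreatest.csSup_eq ⟨?_, ?_⟩
  · obtain ⟨K, i1, i2, i3, φ, ψ, hi, hf⟩ := exists_implements_eq_fidelity hν hϱ
    refine ⟨K, i1, i2, i3, φ, ψ, hi, ?_⟩
    rw [hf, Complex.norm_real, Real.norm_eq_abs, sq_abs]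
  · rintro _ ⟨K, _, _, _, φ, ψ, hi, rfl⟩
    exact pow_le_pow_left₀ (norm_nonneg _) (hi.norm_inner_le hν hϱ) 2

/-- Minimizing ‖ψ - φ‖ amounts to maximizing Re ⟨φ, ψ⟩, because ‖φ‖² = ν(1) and ‖ψ‖² = ϱ(1) are
fixed. -/
theorem buresDist_sq (hν : IsPositiveForm ν) (hϱ : IsPositiveForm ϱ) :
    buresDist ν ϱ ^ 2 = (ν 1).re + (ϱ 1).re - 2 * fidelity ν ϱ := by
  obtain ⟨K, i1, i2, i3, φ, ψ, hi, hf⟩ := exists_implements_eq_fidelity hν hϱ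
  have h0 := hi.norm_sub_sq
  rw [hf, Complex.ofReal_re] at h0
  have : buresDist ν ϱ = ‖ψ - φ‖ := by
    refine IsLeast.csInf_eq ⟨⟨K, i1, i2, i3, φ, ψ, hi, rfl⟩, ?_⟩
    rintro _ ⟨K', _, _, _, φ', ψ', hi', rfl⟩
    rw [← sq_le_sq₀ (norm_nonneg _) (norm_nonneg _), h0, hi'.norm_sub_sq]
    have := (Complex.re_le_norm _).trans (hi'.norm_inner_le hν hϱ)
    linarith
  rw [this, h0]

end Distance

/-! ### The commutant of a representation -/

section Commutant

open ContinuousLinearMap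

variable {M : Type u} [CStarAlgebra M]
variable {K : Type u} [NormedAddCommGroup K] [InnerProductSpace ℂ K] [CompleteSpace K]
  {π : M →⋆ₐ[ℂ] (K →L[ℂ] K)}

/-- An operator that is invariant together with its adjoint on a subspace commutes with the
orthogonal projection onto it. -/
theorem map_starProjection {S : Submodule ℂ K} [S.HasOrthogonalProjection] {c : K →L[ℂ] K}
    (h₁ : ∀ v ∈ S, c v ∈ S) (h₂ : ∀ v ∈ S, adjoint c v ∈ S) (v : K) :
    S.starProjection (c v) = c (S.starProjection v) := by
  refine Submodule.eq_starProjection_of_mem_of_inner_eq_zero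
    (h₁ _ (Submodule.starProjection_apply_mem S v)) fun w hw => ?_
  rw [← map_sub, ← adjoint_inner_right]
  exact Submodule.starProjection_inner_eq_zero v _ (h₂ w hw)

omit [CompleteSpace K] in
theorem map_mem_span_closure {s : Set K} {c : K →L[ℂ] K}
    (h : ∀ v ∈ s, c v ∈ (Submodule.span ℂ s).topologicalClosure) :
    ∀ v ∈ (Submodule.span ℂ s).topologicalClosure,
      c v ∈ (Submodule.span ℂ s).topologicalClosure := by
  have h1 : Submodule.span ℂ s ≤
      (Submodule.span ℂ s).topologicalClosure.comap c.toLinearMap :=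
    Submodule.span_le.mpr h
  exact Submodule.topologicalClosure_minimal _ h1
    ((Submodule.isClosed_topologicalClosure _).preimage c.continuous)

variable (π) in
/-- The operators that commute with a representation. -/
def commutant : Set (K →L[ℂ] K) := {c | ∀ a v, c (π a v) = π a (c v)}

theorem one_mem_commutant : (1 : K →L[ℂ] K) ∈ commutant π := fun _ _ => rfl

theorem adjoint_mem_commutant {c : K →L[ℂ] K} (hc : c ∈ commutant π) :
    adjoint c ∈ commutant π := by
  intro a v
  refine ext_inner_left ℂ fun w => ?_
  rw [adjoint_inner_right, ← star_star a, ← inner_rep_left, ← inner_rep_left,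
    adjoint_inner_right, hc]

theorem comp_mem_commutant {c d : K →L[ℂ] K} (hc : c ∈ commutant π) (hd : d ∈ commutant π) :
    c ∘L d ∈ commutant π := by
  intro a v
  rw [comp_apply, hd, hc, comp_apply]

theorem add_smul_mem_commutant {c d : K →L[ℂ] K} (hc : c ∈ commutant π) (hd : d ∈ commutant π)
    (u : ℂ) : c + u • d ∈ commutant π := by
  intro a v
  simp only [add_apply, smul_apply, map_add, map_smul, hc a v, hd a v]

end Commutant

/-! ### Existence of the largest orthogonal subordinate form -/

section Existence

open ContinuousLinearMap

variable {M : Type u} [CStarAlgebra M] [PartialOrder M] [StarOrderedRing M]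
variable {K : Type u} [NormedAddCommGroup K] [InnerProductSpace ℂ K] [CompleteSpace K]
  {π : M →⋆ₐ[ℂ] (K →L[ℂ] K)} {ν ϱ τ : StrongDual ℂ M}

/-- For a vector `ζ` that attains the fidelity, the functional `c ↦ ⟨ζ, cη⟩` is purely imaginary on
the skew-adjoint operators of the commutant. -/
theorem re_inner_skew_eq_zero (hν : IsPositiveForm ν) (hϱ : IsPositiveForm ϱ) {η ζ : K}
    (hη : vectorForm π η = ϱ) (hζ : ∀ y, ‖π y ζ‖ ^ 2 ≤ 1 * (ν (star y * y)).re)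
    (hf : ⟪ζ, η⟫_ℂ = fidelity ν ϱ) {k : K →L[ℂ] K} (hk : k ∈ commutant π)
    (hskew : adjoint k = -k) : (⟪ζ, k η⟫_ℂ).re = 0 := by
  -- Perturb ζ to ζ - t kζ. As k is skew, ‖π(y)ζ‖² changes only by t²‖kπ(y)ζ‖², with no first-order
  -- term.
  refine eq_zero_of_forall_sq_le (p := fidelity ν ϱ) (B := ‖k‖ ^ 2) fun t => ?_
  have hcomm : ∀ y, π y (ζ - (t : ℂ) • k ζ) = π y ζ - (t : ℂ) • k (π y ζ) := by
    intro y
    rw [map_sub, map_smul, hk]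
  have horth : ∀ v : K, (⟪v, k v⟫_ℂ).re = 0 := by
    intro v
    have h1 : ⟪v, k v⟫_ℂ = -⟪k v, v⟫_ℂ := by
      rw [← adjoint_inner_left, hskew, neg_apply, inner_neg_left]
    have h2 := congrArg Complex.re h1
    rw [← inner_conj_symm, Complex.neg_re, Complex.conj_re] at h2
    have h3 : (⟪k v, v⟫_ℂ).re = (⟪v, k v⟫_ℂ).re := by
      rw [← inner_conj_symm, Complex.conj_re]
    linarith
  have hd : Dominated (1 + t ^ 2 * ‖k‖ ^ 2) ν ϱ (pairForm π (ζ - (t : ℂ) • k ζ) η) := by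
    refine dominated_pairForm (fun y => ?_) (fun x => (norm_rep_sq hη x).le)
    rw [hcomm, norm_sub_sq (𝕜 := ℂ), inner_smul_right, RCLike.re_to_complex,
      Complex.re_ofReal_mul, horth, norm_smul, mul_pow, Complex.norm_real, Real.norm_eq_abs, sq_abs]
    have h1 := pow_le_pow_left₀ (norm_nonneg _) (k.le_opNorm (π y ζ)) 2
    rw [mul_pow] at h1
    have h2 := hζ y
    rw [one_mul] at h2
    have h3 := mul_le_mul_of_nonneg_left h1 (sq_nonneg t)
    have h4 := mul_le_mul_of_nonneg_left h2 (mul_nonneg (sq_nonneg t) (sq_nonneg ‖k‖))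
    linarith
  have h1 := hd.norm_sq_apply_one_le hν hϱ (by positivity)
  rw [pairForm_apply, rep_one_apply, inner_sub_left, inner_smul_left, hf, Complex.conj_ofReal,
    ← adjoint_inner_right, hskew, neg_apply, inner_neg_right, mul_neg, sub_neg_eq_add] at h1
  refine le_trans ?_ h1
  rw [← sq_abs]
  have := Complex.abs_re_le_norm ((fidelity ν ϱ : ℂ) + (t : ℂ) * ⟪ζ, k η⟫_ℂ)
  rw [Complex.add_re, Complex.ofReal_re, Complex.re_ofReal_mul] at this
  exact pow_le_pow_left₀ (abs_nonneg _) this 2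

/-- Both c - c* and i(c + c*) are skew-adjoint in the commutant; they yield the real and the
imaginary part. -/
theorem inner_adjoint_eq_conj (hν : IsPositiveForm ν) (hϱ : IsPositiveForm ϱ) {η ζ : K}
    (hη : vectorForm π η = ϱ) (hζ : ∀ y, ‖π y ζ‖ ^ 2 ≤ 1 * (ν (star y * y)).re)
    (hf : ⟪ζ, η⟫_ℂ = fidelity ν ϱ) {c : K →L[ℂ] K} (hc : c ∈ commutant π) :
    ⟪ζ, adjoint c η⟫_ℂ = conj ⟪ζ, c η⟫_ℂ := by
  have hc' := adjoint_mem_commutant hc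
  have h1 := re_inner_skew_eq_zero hν hϱ hη hζ hf
    (add_smul_mem_commutant hc hc' (-1)) (by
      rw [map_add, LinearIsometryEquiv.map_smulₛₗ, adjoint_adjoint]
      simp)
  have h2 := re_inner_skew_eq_zero hν hϱ hη hζ hf
    (k := Complex.I • c + Complex.I • adjoint c) (fun a v => by
      simp only [add_apply, smul_apply, map_add, map_smul, hc a v, hc' a v]) (by
      rw [map_add, LinearIsometryEquiv.map_smulₛₗ, LinearIsometryEquiv.map_smulₛₗ,
        adjoint_adjoint]
      simp [add_comm])
  simp only [add_apply, smul_apply, inner_add_right, inner_smul_right] at h1 h2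
  simp only [Complex.add_re, Complex.mul_re, Complex.I_re, Complex.I_im, Complex.neg_re,
    Complex.one_re, Complex.neg_im, Complex.one_im] at h1 h2
  apply Complex.ext
  · rw [Complex.conj_re]; linarith
  · rw [Complex.conj_im]; linarith

/-- The largest form that is subordinate to `ϱ` and orthogonal to `ν` exists, and splitting it off
does not change the fidelity. -/
theorem exists_isLargestOrthogonal (hν : IsPositiveForm ν) (hϱ : IsPositiveForm ϱ) :
    ∃ σ, IsLargestOrthogonal ν ϱ σ ∧ fidelity ν (ϱ - σ) = fidelity ν ϱ := by
  obtain ⟨h, hd, h1⟩ := exists_dominated_eq_fidelity hν hϱ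
  obtain ⟨K, _, _, _, π, η, hη, hcyc⟩ := hϱ.exists_cyclic
  obtain ⟨ζ, hζ, hζν⟩ := hd.exists_vector hν zero_le_one hη hcyc
  have hf : ⟪ζ, η⟫_ℂ = fidelity ν ϱ := by rw [← h1, hζ, rep_one_apply]
  -- `e` projects onto the closure of the orbit of `η` under the commutant
  set s : Set K := (fun c : K →L[ℂ] K => c η) '' commutant π with hs
  set E := (Submodule.span ℂ s).topologicalClosure with hE
  have : CompleteSpace E := (Submodule.isClosed_topologicalClosure _).completeSpace_coe
  have hηE : η ∈ E := Submodule.le_topologicalClosure _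
    (Submodule.subset_span ⟨1, one_mem_commutant, rfl⟩)
  have hEinv : ∀ c ∈ commutant π, ∀ v ∈ E, c v ∈ E := by
    intro c hc
    refine map_mem_span_closure ?_
    rintro _ ⟨d, hd, rfl⟩
    exact Submodule.le_topologicalClosure _
      (Submodule.subset_span ⟨c ∘L d, comp_mem_commutant hc hd, rfl⟩)
  have he : ∀ c ∈ commutant π, ∀ v, E.starProjection (c v) = c (E.starProjection v) :=
    fun c hc => map_starProjection (hEinv c hc) (hEinv _ (adjoint_mem_commutant hc))
  -- `q` projects onto the closed invariant subspace generated by `eζ`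
  set w : Set K := Set.range fun x : M => π x (E.starProjection ζ) with hw
  set W := (Submodule.span ℂ w).topologicalClosure with hW
  have : CompleteSpace W := (Submodule.isClosed_topologicalClosure _).completeSpace_coe
  have hWinv : ∀ a : M, ∀ v ∈ W, π a v ∈ W := by
    intro a
    refine map_mem_span_closure ?_
    rintro _ ⟨x, rfl⟩
    exact Submodule.le_topologicalClosure _
      (Submodule.subset_span ⟨a * x, rep_mul_apply π a x _⟩)
  set q := W.starProjection with hq
  have hqπ : ∀ a v, q (π a v) = π a (q v) := by
    intro a
    refine map_starProjection (hWinv a) ?_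
    rw [← star_eq_adjoint, ← map_star]
    exact hWinv _
  have hqs : ∀ u v : K, ⟪q u, v⟫_ℂ = ⟪u, q v⟫_ℂ := W.starProjection_isSymmetric
  have hqe : q (E.starProjection ζ) = E.starProjection ζ :=
    Submodule.starProjection_eq_self_iff.mpr (Submodule.le_topologicalClosure _
      (Submodule.subset_span ⟨1, rep_one_apply π _⟩))
  -- Cutting η down to qη loses nothing: e fixes η and commutes with q, and q fixes eζ.
  have hqf : ⟪ζ, q η⟫_ℂ = fidelity ν ϱ := by
    have hEη : E.starProjection η = η := Submodule.starProjection_eq_self_iff.mpr hηE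
    calc ⟪ζ, q η⟫_ℂ = ⟪ζ, q (E.starProjection η)⟫_ℂ := by rw [hEη]
      _ = ⟪ζ, E.starProjection (q η)⟫_ℂ := by rw [he q hqπ]
      _ = ⟪q (E.starProjection ζ), η⟫_ℂ := by rw [hqs, E.starProjection_isSymmetric.apply_clm]
      _ = ⟪ζ, η⟫_ℂ := by rw [hqe, E.starProjection_isSymmetric.apply_clm, hEη]
      _ = fidelity ν ϱ := hf
  have hpyth : ∀ v : K, ‖v‖ ^ 2 = ‖q v‖ ^ 2 + ‖v - q v‖ ^ 2 := by
    intro v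
    have := Submodule.norm_sq_eq_add_norm_sq_starProjection v W
    rwa [Submodule.starProjection_orthogonal_val] at this
  have hπq : ∀ x, π x (η - q η) = π x η - q (π x η) := fun x => by rw [map_sub, hqπ]
  set σ := vectorForm π (η - q η) with hσ
  have hσpos : IsPositiveForm σ := isPositiveForm_vectorForm π _
  have hσx : ∀ x, (σ (star x * x)).re = ‖π x η - q (π x η)‖ ^ 2 := fun x => by
    rw [← norm_rep_sq hσ.symm, hπq]
  have hϱx : ∀ x, (ϱ (star x * x)).re = ‖q (π x η)‖ ^ 2 + ‖π x η - q (π x η)‖ ^ 2 := fun x => by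
    rw [← norm_rep_sq hη, ← hpyth]
  have hσϱ : Subordinate σ ϱ := by
    rw [subordinate_iff hσpos hϱ]
    intro x
    rw [hσx, hϱx]
    exact le_add_of_nonneg_left (sq_nonneg _)
  have hle : Subordinate (ϱ - σ) ϱ := by
    unfold Subordinate; rwa [sub_sub_cancel]
  have hfid : fidelity ν (ϱ - σ) = fidelity ν ϱ := by
    refine le_antisymm (fidelity_mono hν hσϱ hν hϱ ?_ hle) ?_
    · intro x _; simp
    · have hdq : Dominated 1 ν (ϱ - σ) (pairForm π ζ (q η)) := by
        refine dominated_pairForm hζν fun x => ?_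
        rw [sub_apply, Complex.sub_re, hσx, hϱx, ← hqπ, add_sub_cancel_right]
      have := hdq.norm_apply_one_le hν hσϱ
      rwa [pairForm_apply, rep_one_apply, hqf, Complex.norm_real,
        Real.norm_of_nonneg (fidelity_nonneg hν hϱ)] at this
  have hσν : fidelity ν σ = 0 := by
    have := fidelity_sub_eq_zero hν hϱ hσϱ hle hfid
    rwa [sub_sub_cancel] at this
  refine ⟨σ, ⟨hσpos, hσϱ, ?_, ?_⟩, hfid⟩
  · rw [orthogonal_iff hσpos hν, fidelity_comm hσpos hν, hσν]
  intro τ hτ hτϱ hτν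
  rw [orthogonal_iff hτ hν, fidelity_comm hτ hν] at hτν
  obtain ⟨K', _, _, _, π', η', hη', -⟩ := hτ.exists_cyclic
  obtain ⟨V, hVη, hVπ, hVn⟩ := exists_intertwiner hτϱ hη hcyc hη'
  -- c is the Radon-Nikodym derivative of τ: τ(y*x) = ⟨π(y)η, cπ(x)η⟩.
  set c := adjoint V ∘L V with hc
  have hcV : ∀ u v : K, ⟪u, c v⟫_ℂ = ⟪V u, V v⟫_ℂ := fun u v => by
    rw [hc, comp_apply, adjoint_inner_right]
  have hcs : ∀ u v : K, ⟪c u, v⟫_ℂ = ⟪u, c v⟫_ℂ := fun u v => by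
    rw [hcV, hc, comp_apply, adjoint_inner_left]
  have hcadj : adjoint c = c := by
    ext v
    refine ext_inner_left ℂ fun u => ?_
    rw [adjoint_inner_right, hcs]
  have hcc : c ∈ commutant π := by
    intro a v
    refine ext_inner_left ℂ fun u => ?_
    rw [hcV, hVπ, ← star_star a, ← inner_rep_left, ← hVπ, ← hcV, inner_rep_left, star_star]
  -- ⟨ζ, d*cη⟩ is the value at 1 of a form dominated by a multiple of the pair {ν, τ}, whose
  -- fidelity is zero.
  have hker : ∀ d ∈ commutant π, ⟪ζ, adjoint d (c η)⟫_ℂ = 0 := by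
    intro d hd
    have hdom : Dominated (‖d‖ ^ 2) ν τ (pairForm π' (V (d ζ)) η') := by
      refine dominated_pairForm (fun y => ?_) (fun x => (norm_rep_sq hη' x).le)
      rw [← hVπ, ← hd]
      have h1 := (hVn (d (π y ζ))).trans (d.le_opNorm (π y ζ))
      have h2 := hζν y
      rw [one_mul] at h2
      calc ‖V (d (π y ζ))‖ ^ 2 ≤ (‖d‖ * ‖π y ζ‖) ^ 2 := pow_le_pow_left₀ (norm_nonneg _) h1 2
        _ = ‖d‖ ^ 2 * ‖π y ζ‖ ^ 2 := mul_pow _ _ _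
        _ ≤ _ := by gcongr
    have := hdom.norm_sq_apply_one_le hν hτ (sq_nonneg _)
    rw [hτν, zero_pow two_ne_zero, mul_zero, pairForm_apply, rep_one_apply, ← hVη, ← hcV] at this
    rw [adjoint_inner_right]
    exact norm_eq_zero.mp (pow_eq_zero_iff two_ne_zero |>.mp (le_antisymm this (sq_nonneg _)))
  -- As c commutes with e, this says cζ ⊥ dη for all d in the commutant. Hermiticity turns ⟨ζ, d*cη⟩
  -- = 0 into ⟨ζ, cdη⟩ = 0.
  have hcE : c (E.starProjection ζ) = 0 := by
    rw [← he c hcc, Submodule.starProjection_apply_eq_zero_iff, hE,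
      Submodule.orthogonal_closure, Submodule.mem_orthogonal]
    intro u hu
    induction hu using Submodule.span_induction with
    | mem u hu =>
      obtain ⟨d, hd, rfl⟩ := hu
      have h2 := inner_adjoint_eq_conj hν hϱ hη hζν hf
        (comp_mem_commutant (adjoint_mem_commutant hd) hcc)
      rw [comp_apply, hker d hd, map_zero, adjoint_comp, adjoint_adjoint, hcadj,
        comp_apply] at h2
      rw [← inner_conj_symm, hcs, h2, map_zero]
    | zero => exact inner_zero_left _
    | add u v _ _ hu hv => rw [inner_add_left, hu, hv, add_zero]
    | smul a u _ hu => rw [inner_smul_left, hu, mul_zero]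
  have hcW : ∀ v ∈ W, V v = 0 := by
    have h3 : ∀ v, c v = 0 → V v = 0 := by
      intro v hv
      have := hcV v v
      rwa [hv, inner_zero_right, eq_comm, inner_self_eq_zero] at this
    have h4 : Submodule.span ℂ w ≤ LinearMap.ker V.toLinearMap := by
      rw [Submodule.span_le]
      rintro _ ⟨x, rfl⟩
      refine h3 _ ?_
      rw [hcc, hcE, map_zero]
    exact Submodule.topologicalClosure_minimal _ h4 V.isClosed_ker
  rw [subordinate_iff hτ hσpos]
  intro x
  rw [hσx, ← norm_rep_sq hη', ← hVη, ← hVπ]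
  refine pow_le_pow_left₀ (norm_nonneg _) ?_ 2
  -- V kills the range of q, so Vπ(x)η = V(π(x)η - qπ(x)η), and V is a contraction.
  have h5 := hVn (π x η - q (π x η))
  rwa [map_sub, hcW _ (Submodule.starProjection_apply_mem W _), sub_zero] at h5

end Existence

/-! ### Minimality of the reduced pair -/

section Perp

variable {M : Type u} [CStarAlgebra M] [PartialOrder M] [StarOrderedRing M]
  {ν ϱ σ τ : StrongDual ℂ M}

theorem IsLargestOrthogonal.unique (h₁ : IsLargestOrthogonal ν ϱ σ)
    (h₂ : IsLargestOrthogonal ν ϱ τ) : σ = τ :=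
  Subordinate.antisymm (h₂.largest σ h₁.positive h₁.subordinate h₁.orthogonal)
    (h₁.largest τ h₂.positive h₂.subordinate h₂.orthogonal)

theorem isLargestOrthogonal_perp (hν : IsPositiveForm ν) (hϱ : IsPositiveForm ϱ) :
    IsLargestOrthogonal ν ϱ (perp ν ϱ) := by
  have h : ∃ σ, IsLargestOrthogonal ν ϱ σ := (exists_isLargestOrthogonal hν hϱ).imp fun _ h => h.1
  rw [perp, dif_pos h]
  exact h.choose_spec

theorem fidelity_sub_perp (hν : IsPositiveForm ν) (hϱ : IsPositiveForm ϱ) :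
    fidelity ν (ϱ - perp ν ϱ) = fidelity ν ϱ := by
  obtain ⟨σ, hσ, hf⟩ := exists_isLargestOrthogonal hν hϱ
  rwa [(isLargestOrthogonal_perp hν hϱ).unique hσ]

omit [StarOrderedRing M] in
theorem IsPositiveForm.subordinate_sub (hσ : IsPositiveForm σ) : Subordinate (ϱ - σ) ϱ := by
  unfold Subordinate; rwa [sub_sub_cancel]

/-- The form `ϱ - ϱ^⊥` is the least form subordinate to `ϱ` with the same fidelity. -/
theorem sub_perp_subordinate (hν : IsPositiveForm ν) (hϱ : IsPositiveForm ϱ)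
    (hτ : IsPositiveForm τ) (hs : Subordinate τ ϱ) (hf : fidelity ν τ = fidelity ν ϱ) :
    Subordinate (ϱ - perp ν ϱ) τ := by
  have h0 := fidelity_sub_eq_zero hν hϱ hτ hs hf
  have := (isLargestOrthogonal_perp hν hϱ).largest (ϱ - τ) hs hτ.subordinate_sub
    ((orthogonal_iff hs hν).mpr (by rw [fidelity_comm hs hν, h0]))
  unfold Subordinate at this ⊢
  rwa [show τ - (ϱ - perp ν ϱ) = perp ν ϱ - (ϱ - τ) by abel]

/-- Splitting off a further orthogonal part would preserve the fidelity again, so minimality of ϱ -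
ϱ^⊥ forces that part to vanish. -/
theorem perp_sub_perp (hν : IsPositiveForm ν) (hϱ : IsPositiveForm ϱ) :
    perp ν (ϱ - perp ν ϱ) = 0 := by
  have h₁ := isLargestOrthogonal_perp hν hϱ
  have h₂ := isLargestOrthogonal_perp hν h₁.subordinate
  have hs := h₂.positive.subordinate_sub (ϱ := ϱ - perp ν ϱ)
  have := sub_perp_subordinate hν hϱ h₂.subordinate (hs.trans h₁.positive.subordinate_sub)
    ((fidelity_sub_perp hν h₁.subordinate).trans (fidelity_sub_perp hν hϱ))
  exact (sub_eq_self.mp (hs.antisymm this))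

/-- One inequality is minimality of ν - ν^⊥: removing the new orthogonal part from ν still leaves
F(ν, ϱ). The other holds because ν^⊥, being orthogonal to ϱ, is orthogonal to the smaller ϱ - ϱ^⊥.
-/
theorem perp_sub_perp_left (hν : IsPositiveForm ν) (hϱ : IsPositiveForm ϱ) :
    perp (ϱ - perp ν ϱ) ν = perp ϱ ν := by
  have h₁ := isLargestOrthogonal_perp hν hϱ
  have h₂ := isLargestOrthogonal_perp hϱ hν
  have h₃ := isLargestOrthogonal_perp h₁.subordinate hν
  have hs := h₁.positive.subordinate_sub (ϱ := ϱ)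
  have hs' := h₃.positive.subordinate_sub (ϱ := ν)
  apply Subordinate.antisymm
  · have hf : fidelity ϱ (ν - perp (ϱ - perp ν ϱ) ν) = fidelity ϱ ν := by
      refine le_antisymm (fidelity_mono hϱ h₃.subordinate hϱ hν (by intro x _; simp) hs') ?_
      calc fidelity ϱ ν = fidelity (ϱ - perp ν ϱ) ν := by
            rw [fidelity_comm hϱ hν, ← fidelity_sub_perp hν hϱ, fidelity_comm hν h₁.subordinate]
        _ = fidelity (ϱ - perp ν ϱ) (ν - perp (ϱ - perp ν ϱ) ν) :=
            (fidelity_sub_perp h₁.subordinate hν).symm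
        _ ≤ _ := fidelity_mono h₁.subordinate h₃.subordinate hϱ h₃.subordinate hs
            (by intro x _; simp)
    have := sub_perp_subordinate hϱ hν h₃.subordinate hs' hf
    unfold Subordinate at this ⊢
    rwa [sub_sub_sub_cancel_left] at this
  · refine h₃.largest _ h₂.positive h₂.subordinate ?_
    rw [orthogonal_iff h₂.positive h₁.subordinate]
    refine le_antisymm ?_ (fidelity_nonneg h₂.positive h₁.subordinate)
    rw [← (orthogonal_iff h₂.positive hϱ).mp h₂.orthogonal]
    exact fidelity_mono h₂.positive h₁.subordinate h₂.positive hϱ (by intro x _; simp) hs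

theorem fidelity_sub_perp_sub_perp (hν : IsPositiveForm ν) (hϱ : IsPositiveForm ϱ) :
    fidelity (ν - perp ϱ ν) (ϱ - perp ν ϱ) = fidelity ν ϱ := by
  have h₁ := isLargestOrthogonal_perp hν hϱ
  have h₂ := isLargestOrthogonal_perp hϱ hν
  have := fidelity_sub_perp h₁.subordinate hν
  rwa [perp_sub_perp_left hν hϱ, fidelity_comm h₁.subordinate h₂.subordinate,
    fidelity_comm h₁.subordinate hν, fidelity_sub_perp hν hϱ] at this

theorem fidelity_perp_perp (hν : IsPositiveForm ν) (hϱ : IsPositiveForm ϱ) :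
    fidelity (perp ϱ ν) (perp ν ϱ) = 0 := by
  have h₁ := isLargestOrthogonal_perp hν hϱ
  have h₂ := isLargestOrthogonal_perp hϱ hν
  refine le_antisymm ?_ (fidelity_nonneg h₂.positive h₁.positive)
  rw [← (orthogonal_iff h₂.positive hϱ).mp h₂.orthogonal]
  exact fidelity_mono h₂.positive h₁.positive h₂.positive hϱ (by intro x _; simp) h₁.subordinate

end Perp

end BuresDistance

theorem mainTheorem12 {M : Type u} [CStarAlgebra M] [PartialOrder M] [StarOrderedRing M]
    (ν ϱ : StrongDual ℂ M)
    (hν : BuresDistance.IsPositiveForm ν) (hϱ : BuresDistance.IsPositiveForm ϱ) :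
    -- `ν^⊥` and `ϱ^⊥` exist
    BuresDistance.IsLargestOrthogonal ϱ ν (BuresDistance.perp ϱ ν) ∧
    BuresDistance.IsLargestOrthogonal ν ϱ (BuresDistance.perp ν ϱ) ∧
    -- the `⊥`-operation with respect to the pair `{ν, ϱ - ϱ^⊥}`
    BuresDistance.IsLargestOrthogonal ν (ϱ - BuresDistance.perp ν ϱ)
      (BuresDistance.perp ν (ϱ - BuresDistance.perp ν ϱ)) ∧
    BuresDistance.IsLargestOrthogonal (ϱ - BuresDistance.perp ν ϱ) ν
      (BuresDistance.perp (ϱ - BuresDistance.perp ν ϱ) ν) ∧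
    BuresDistance.perp ν (ϱ - BuresDistance.perp ν ϱ) = 0 ∧
    BuresDistance.perp (ϱ - BuresDistance.perp ν ϱ) ν = BuresDistance.perp ϱ ν ∧
    -- the Bures distance and the transition probability
    BuresDistance.buresDist ν ϱ ^ 2 =
      BuresDistance.buresDist (ν - BuresDistance.perp ϱ ν) (ϱ - BuresDistance.perp ν ϱ) ^ 2 +
      BuresDistance.buresDist (BuresDistance.perp ϱ ν) (BuresDistance.perp ν ϱ) ^ 2 ∧
    BuresDistance.transitionProb ν ϱ =
      BuresDistance.transitionProb (ν - BuresDistance.perp ϱ ν) (ϱ - BuresDistance.perp ν ϱ) ∧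
    -- `{ν - ν^⊥, ϱ - ϱ^⊥}` is a subordinate pair of positive forms (with the same transition
    -- probability, by the preceding item), and the least one
    BuresDistance.IsPositiveForm (ν - BuresDistance.perp ϱ ν) ∧
    BuresDistance.IsPositiveForm (ϱ - BuresDistance.perp ν ϱ) ∧
    BuresDistance.Subordinate (ν - BuresDistance.perp ϱ ν) ν ∧
    BuresDistance.Subordinate (ϱ - BuresDistance.perp ν ϱ) ϱ ∧
    ∀ θ θ' : StrongDual ℂ M,
      BuresDistance.IsPositiveForm θ → BuresDistance.IsPositiveForm θ' →
      BuresDistance.Subordinate θ ν → BuresDistance.Subordinate θ' ϱ →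
      BuresDistance.transitionProb θ θ' = BuresDistance.transitionProb ν ϱ →
      BuresDistance.Subordinate (ν - BuresDistance.perp ϱ ν) θ ∧
      BuresDistance.Subordinate (ϱ - BuresDistance.perp ν ϱ) θ' := by
  have h₁ := BuresDistance.isLargestOrthogonal_perp hν hϱ
  have h₂ := BuresDistance.isLargestOrthogonal_perp hϱ hν
  have hs₁ := h₁.positive.subordinate_sub (ϱ := ϱ)
  have hs₂ := h₂.positive.subordinate_sub (ϱ := ν)
  refine ⟨h₂, h₁, BuresDistance.isLargestOrthogonal_perp hν h₁.subordinate,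
    BuresDistance.isLargestOrthogonal_perp h₁.subordinate hν, BuresDistance.perp_sub_perp hν hϱ,
    BuresDistance.perp_sub_perp_left hν hϱ, ?_, ?_, h₂.subordinate, h₁.subordinate, hs₂, hs₁, ?_⟩
  · rw [BuresDistance.buresDist_sq hν hϱ, BuresDistance.buresDist_sq h₂.subordinate h₁.subordinate,
      BuresDistance.buresDist_sq h₂.positive h₁.positive,
      BuresDistance.fidelity_sub_perp_sub_perp hν hϱ, BuresDistance.fidelity_perp_perp hν hϱ]
    -- What remains is additivity of the masses ν(1) and ϱ(1).
    simp only [sub_apply, Complex.sub_re]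
    ring
  · rw [BuresDistance.transitionProb_eq hν hϱ,
      BuresDistance.transitionProb_eq h₂.subordinate h₁.subordinate,
      BuresDistance.fidelity_sub_perp_sub_perp hν hϱ]
  · intro θ θ' hθ hθ' hθν hθϱ hP
    rw [BuresDistance.transitionProb_eq hθ hθ', BuresDistance.transitionProb_eq hν hϱ,
      sq_eq_sq₀ (BuresDistance.fidelity_nonneg hθ hθ') (BuresDistance.fidelity_nonneg hν hϱ)] at hP
    have hrefl : ∀ f : StrongDual ℂ M, BuresDistance.Subordinate f f := by
      intro f x _; simp
    constructor
    · refine BuresDistance.sub_perp_subordinate hϱ hν hθ hθν ?_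
      rw [BuresDistance.fidelity_comm hϱ hθ, BuresDistance.fidelity_comm hϱ hν]
      -- Monotonicity squeezes F(θ, ϱ) between F(θ, θ') and F(ν, ϱ), which agree; the two components
      -- can thus be treated separately.
      exact le_antisymm (BuresDistance.fidelity_mono hθ hϱ hν hϱ hθν (hrefl ϱ))
        (hP ▸ BuresDistance.fidelity_mono hθ hθ' hθ hϱ (hrefl θ) hθϱ)
    · refine BuresDistance.sub_perp_subordinate hν hϱ hθ' hθϱ ?_
      exact le_antisymm (BuresDistance.fidelity_mono hν hθ' hν hϱ (hrefl ν) hθϱ)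
        (hP ▸ BuresDistance.fidelity_mono hθ hθ' hν hθ' hθν (hrefl θ'))
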